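/- Let $n\ge 2$. For $g\in\mathrm{SU}(n)$ let $\phi(g)$ be the unitary that $g$ induces on $\bigoplus_{k=0}^n\bigwedge^k\mathbb C^n\cong(\mathbb C^2)^{\otimes n}$, where the bit string $|s\rangle$ corresponds to $\bigwedge_{s_i=1}e_i$ (factors in increasing order); $\phi$ is the quantum compound ansatz on $n$ qubits for $\mathrm{SU}(n)$, and its restriction to $\mathrm{SO}(n)$ is the one for $\mathrm{SO}(n)$. The generators are $H=d\phi(h)$ with $h=-\tfrac i2X^{(ij)}$, $-\tfrac i2Y^{(ij)}$ or $-\tfrac i2Z^{(ij)}$ for $i\ne j$ (for $\mathrm{SO}(n)$ only $h=-\tfrac i2Y^{(ij)}$), where $X^{(ij)},Y^{(ij)},Z^{(ij)}$ are the Pauli matrices on the $2\times2$ block of $i,j$ and zero elsewhere. For the compact group $G=\mathrm{SU}(n)$ or $G=\mathrm{SO}(n)$ with Haar probability measure $\mu$, $h$ in its Lie algebra $\mathfrak g$, $H=d\phi(h)$, an observable $O$ and a state $\rho$ put $$\mathrm{GradVar}=\operatorname{Var}_{(g^+,g^-)\sim\mu\otimes\mu}\,\mathrm{Tr}\Big(\phi(g^-)^\dagger\rho\,\phi(g^-)\,\big[H,\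 \phi(g^+)\,O\,\phi(g^+)^\dagger\big]\Big).$$ For each of the two groups, $i\sigma^z_j$ is not in the dynamical Lie algebra (the real Lie algebra generated by the operators $d\phi(h)$, $h$ a generator), for every qubit $j$. Nevertheless there are a constant $C>0$ and an exponent $d\in\mathbb N$ such that the following holds for every $n\ge2$, for both groups, and for every initial state $\rho=|\psi\rangle\langle\psi|$ where $|\psi\rangle$ is either a computational basis state other than $|0\cdots0\rangle$ and $|1\cdots1\rangle$, or the uniform superposition of all computational basis states. 1. If $O=\sigma^z_j$ for some qubit $j$ and $H$ is one of the generators, then $\mathrm{GradVar}\ge C/n^d$; that is, $\mathrm{GradVar}\in\Omega(1/\mathrm{poly}(n))$. 2. If, more generally, $O=\sum_{j=1}^n c_j\sigma^z_j$ with real $c_j$, and $H=d\phi(h)$ with any $h\in\mathfrak g$, then $$\mathrm{GradVar}\ \ge\ \frac C{n^d}\,\|h\|_{\mathfrak g}^2\,\sum_{j=1}^n(c_j-\bar c)^2,\qquad \|h\|_{\mathfrak g}^2=-\mathrm{Tr}(h^2),\quad \bar c=\frac1n\sum_{j=1}^n c_j .$$ -/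

import Mathlib

open MeasureTheory

/-- Labels of the computational basis of `n` qubits: bit strings of length `n`. -/
abbrev Qubits (n : ℕ) : Type := Fin n → Fin 2

/-- The qubits that are in the state `1` in a bit string. -/
def occupied {n : ℕ} (s : Qubits n) : Finset (Fin n) :=
  Finset.univ.filter fun i => s i = 1

/-- The matrix, in the basis of bit strings `|s⟩ = ⋀_{s i = 1} e_i` (factors in increasing order),
of the map induced by `g` on the exterior algebra `⨁ₖ ⋀ᵏ ℂⁿ`, the state space of `n` qubits:
the entry at `(s, t)` is the minor of `g` with rows `occupied s` and columns `occupied t` if both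
have the same number of elements (the same Hamming weight), and `0` otherwise. -/
noncomputable def compoundMatrix {n : ℕ} (g : Matrix (Fin n) (Fin n) ℂ) :
    Matrix (Qubits n) (Qubits n) ℂ :=
  Matrix.of fun s t =>
    if h : (occupied t).card = (occupied s).card then
      (g.submatrix ((occupied s).orderEmbOfFin rfl) ((occupied t).orderEmbOfFin h)).det
    else 0

/-- The differential of `compoundMatrix` at the identity: the derivative at `τ = 0` of
`compoundMatrix (exp (τ h))`, entry by entry. -/
noncomputable def compoundDifferential {n : ℕ} (h : Matrix (Fin n) (Fin n) ℂ) :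
    Matrix (Qubits n) (Qubits n) ℂ :=
  Matrix.of fun s t =>
    deriv (fun τ : ℝ => compoundMatrix (NormedSpace.exp (τ • h)) s t) 0

section Groups

variable {n : ℕ} {𝕜 : Type*} [RCLike 𝕜]

/-- The Borel sigma-algebra of `SU(n)` (for `𝕜 = ℂ`) and of `SO(n)` (for `𝕜 = ℝ`). -/
instance instMeasurableSpaceSU :
    MeasurableSpace (Matrix.specialUnitaryGroup (Fin n) 𝕜) := borel _

instance instBorelSpaceSU : BorelSpace (Matrix.specialUnitaryGroup (Fin n) 𝕜) := ⟨rfl⟩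

instance instIsTopologicalGroupSU :
    IsTopologicalGroup (Matrix.specialUnitaryGroup (Fin n) 𝕜) where
  continuous_inv := by
    refine Continuous.subtype_mk ?_ _
    exact continuous_subtype_val.star

theorem norm_entry_le_one {A : Matrix (Fin n) (Fin n) 𝕜}
    (hA : A ∈ Matrix.specialUnitaryGroup (Fin n) 𝕜) (i j : Fin n) : ‖A i j‖ ≤ 1 :=
  entry_norm_bound_of_unitary (Matrix.mem_specialUnitaryGroup_iff.1 hA).1 i j

instance instCompactSpaceSU : CompactSpace (Matrix.specialUnitaryGroup (Fin n) 𝕜) := by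
  suffices h : IsCompact
      (Matrix.specialUnitaryGroup (Fin n) 𝕜 : Set (Matrix (Fin n) (Fin n) 𝕜)) from
    isCompact_iff_compactSpace.1 h
  have hK : IsCompact (Set.pi Set.univ fun _ : Fin n => Set.pi Set.univ fun _ : Fin n =>
      Metric.closedBall (0 : 𝕜) 1) :=
    isCompact_univ_pi fun _ => isCompact_univ_pi fun _ => isCompact_closedBall _ _
  refine IsCompact.of_isClosed_subset (s := Set.pi Set.univ fun _ : Fin n =>
    Set.pi Set.univ fun _ : Fin n => Metric.closedBall (0 : 𝕜) 1) hK ?_ ?_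
  · have : (Matrix.specialUnitaryGroup (Fin n) 𝕜 : Set (Matrix (Fin n) (Fin n) 𝕜)) =
        {A | A * star A = 1} ∩ {A | A.det = 1} := by
      ext A
      simp [Matrix.mem_specialUnitaryGroup_iff, Matrix.mem_unitaryGroup_iff]
    rw [this]
    refine IsClosed.inter (isClosed_eq ?_ continuous_const) (isClosed_eq ?_ continuous_const)
    · exact (continuous_id (X := Matrix (Fin n) (Fin n) 𝕜)).mul continuous_id.star
    · exact Continuous.matrix_det continuous_id
  · intro A hA i _ j _
    simpa using norm_entry_le_one hA i j

end Groups

/-- The Haar probability measure of a compact group. -/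
noncomputable def haarProb (G : Type*) [Group G] [TopologicalSpace G] [IsTopologicalGroup G]
    [CompactSpace G] [MeasurableSpace G] [BorelSpace G] : Measure G :=
  Measure.haarMeasure ⊤

/-- The abstracted gradient `Tr (U₋† ρ U₋ [H, U₊ O U₊†])`. -/
noncomputable def abstractedGradient {ι : Type*} [Fintype ι] (H O ρ Up Um : Matrix ι ι ℂ) : ℂ :=
  (Um.conjTranspose * ρ * Um *
    (H * (Up * O * Up.conjTranspose) - (Up * O * Up.conjTranspose) * H)).trace

/-- The abstracted gradient is real for a skew-Hermitian generator and Hermitian observable and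
state. -/
theorem abstractedGradient_im {ι : Type*} [Fintype ι] {H O ρ : Matrix ι ι ℂ}
    (Up Um : Matrix ι ι ℂ) (hH : H.conjTranspose = -H) (hO : O.IsHermitian)
    (hρ : ρ.IsHermitian) : (abstractedGradient H O ρ Up Um).im = 0 := by
  rw [← Complex.conj_eq_iff_im]
  have h1 := Matrix.trace_conjTranspose (Um.conjTranspose * ρ * Um *
    (H * (Up * O * Up.conjTranspose) - (Up * O * Up.conjTranspose) * H))
  unfold abstractedGradient
  rw [starRingEnd_apply, ← h1, Matrix.conjTranspose_mul, Matrix.trace_mul_comm]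
  congr 1
  simp only [Matrix.conjTranspose_sub, Matrix.conjTranspose_mul, Matrix.conjTranspose_conjTranspose,
    hH, hO.eq, hρ.eq, Matrix.mul_assoc]
  congr 1
  rw [sub_eq_add_neg, sub_eq_add_neg, add_comm]
  simp only [Matrix.neg_mul, Matrix.mul_neg, neg_neg]

/-- `GradVar`: the variance of the (real) abstracted gradient for independent Haar distributed
`g₊, g₋`, where `U_g = φ g`. -/
noncomputable def gradVar {G : Type*} [Group G] [TopologicalSpace G] [IsTopologicalGroup G]
    [CompactSpace G] [MeasurableSpace G] [BorelSpace G] {ι : Type*} [Fintype ι]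
    (φ : G → Matrix ι ι ℂ) (H O ρ : Matrix ι ι ℂ) : ℝ :=
  ProbabilityTheory.variance
    (fun g : G × G => (abstractedGradient H O ρ (φ g.1) (φ g.2)).re)
    ((haarProb G).prod (haarProb G))

/-- The quantum compound ansatz for `SU(n)`. -/
noncomputable def compoundSU {n : ℕ} (g : Matrix.specialUnitaryGroup (Fin n) ℂ) :
    Matrix (Qubits n) (Qubits n) ℂ :=
  compoundMatrix (g : Matrix (Fin n) (Fin n) ℂ)

/-- The quantum compound ansatz for `SO(n)`. -/
noncomputable def compoundSO {n : ℕ} (g : Matrix.specialOrthogonalGroup (Fin n) ℝ) :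
    Matrix (Qubits n) (Qubits n) ℂ :=
  compoundMatrix ((g : Matrix (Fin n) (Fin n) ℝ).map Complex.ofReal)

/-- The Lie algebra `su(n)`: traceless skew-Hermitian matrices. -/
def suSet (n : ℕ) : Set (Matrix (Fin n) (Fin n) ℂ) :=
  {h | h.conjTranspose = -h ∧ h.trace = 0}

/-- The Lie algebra `so(n)`: the matrices in `su(n)` with real entries. -/
def soSet (n : ℕ) : Set (Matrix (Fin n) (Fin n) ℂ) :=
  {h | h ∈ suSet n ∧ ∀ i j, (h i j).im = 0}

/-- The squared standard norm `-Tr (h²)` on `su(n)`. -/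
noncomputable def stdNormSq {n : ℕ} (h : Matrix (Fin n) (Fin n) ℂ) : ℝ :=
  (-(h * h).trace).re

/-- The Pauli matrix `σ_x` on the block of the rows and columns `i`, `j`. -/
def pauliX {n : ℕ} (i j : Fin n) : Matrix (Fin n) (Fin n) ℂ :=
  Matrix.single i j 1 + Matrix.single j i 1

/-- The Pauli matrix `σ_y` on the block of the rows and columns `i`, `j`. -/
def pauliY {n : ℕ} (i j : Fin n) : Matrix (Fin n) (Fin n) ℂ :=
  Matrix.single i j (-Complex.I) + Matrix.single j i Complex.I

/-- The Pauli matrix `σ_z` on the block of the rows and columns `i`, `j`. -/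
def pauliZ {n : ℕ} (i j : Fin n) : Matrix (Fin n) (Fin n) ℂ :=
  Matrix.single i i 1 - Matrix.single j j 1

/-- The generators `-(i/2) X^(ij)`, `-(i/2) Y^(ij)`, `-(i/2) Z^(ij)` of the Givens rotations of
`SU(n)`. -/
def suGenerators (n : ℕ) : Set (Matrix (Fin n) (Fin n) ℂ) :=
  {h | ∃ i j : Fin n, i ≠ j ∧
    (h = (-(Complex.I / 2)) • pauliX i j ∨ h = (-(Complex.I / 2)) • pauliY i j ∨
      h = (-(Complex.I / 2)) • pauliZ i j)}

/-- The generators `-(i/2) Y^(ij)` of the Givens rotations of `SO(n)`. -/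
def soGenerators (n : ℕ) : Set (Matrix (Fin n) (Fin n) ℂ) :=
  {h | ∃ i j : Fin n, i ≠ j ∧ h = (-(Complex.I / 2)) • pauliY i j}

section DLA

attribute [local instance] LieRing.ofAssociativeRing

/-- The dynamical Lie algebra of the compound ansatz with a given set of generators: the real
Lie algebra of matrices on the qubits (with the commutator as bracket) that the represented
generators generate. -/
noncomputable def compoundDLA {n : ℕ} (S : Set (Matrix (Fin n) (Fin n) ℂ)) :
    Set (Matrix (Qubits n) (Qubits n) ℂ) :=
  LieSubalgebra.lieSpan ℝ (Matrix (Qubits n) (Qubits n) ℂ) (compoundDifferential '' S)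

end DLA

/-- The Pauli operator `σ_z` on qubit `i`. -/
def sigmaZ {n : ℕ} (i : Fin n) : Matrix (Qubits n) (Qubits n) ℂ :=
  Matrix.diagonal fun s => if s i = 0 then 1 else -1

/-- The computational basis state `|s⟩`. -/
def basisKet {n : ℕ} (s : Qubits n) : Qubits n → ℂ := Pi.single s 1

/-- The uniform superposition of all computational basis states. -/
noncomputable def plusKet (n : ℕ) : Qubits n → ℂ := fun _ => (1 / Real.sqrt (2 ^ n) : ℝ)

/-- The density matrix `|ψ⟩⟨ψ|`. -/
def pureState {ι : Type*} (ψ : ι → ℂ) : Matrix ι ι ℂ := Matrix.vecMulVec ψ (star ψ)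

/-- The initial states: the computational basis states, other than `|0…0⟩` and `|1…1⟩` (which the
whole ansatz fixes), and the uniform superposition. -/
def IsInitialKet {n : ℕ} (ψ : Qubits n → ℂ) : Prop :=
  (∃ s : Qubits n, (∃ i j, s i ≠ s j) ∧ ψ = basisKet s) ∨ ψ = plusKet n

/-- `∑ᵢ (cᵢ - c̄)²`, with `c̄` the mean of the `cᵢ`. -/
noncomputable def spread {n : ℕ} (c : Fin n → ℝ) : ℝ :=
  ∑ i, (c i - (∑ j, c j) / n) ^ 2

/-!
Since `∑ cᵢ σᶻᵢ = (∑ cᵢ) - 2 dφ(diag c)` and `φ(g) dφ(A) φ(g)† = dφ(g A g†)`, the gradient is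
`-2 Re Tr (g₋ [h, g₊ D g₊†] g₋† B)`, where `D` is the traceless part of `diag c` and the traceless
Hermitian `n × n` matrix `B` represents the one-body expectation values of `ρ`. Diagonalising, and
using that phases and permutations preserve Haar measure, the second moment of
`g ↦ Re Tr (g A g† B)` is a constant multiple of `‖A‖² ‖B‖²`; by Parseval the constant is one over
the dimension of the space of traceless Hermitian (for `SO(n)`: symmetric) matrices. Applying this
once to `g₋` and once to `g₊`, and summing over symmetric matrix units to get `‖h‖²`, bounds the
variance below by `‖D‖² ‖h‖² ‖B‖² / n³` up to a constant. A matrix with nonzero expectation bounds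
`‖B‖` below: `Eᵢᵢ - Eⱼⱼ` for a basis state, a hop between neighbouring qubits for the superposition.
The operators `iσᶻⱼ` are not in the dynamical Lie algebra because everything in it annihilates
`|0…0⟩`.
-/

section Compound

variable {n : ℕ}

theorem mem_occupied {s : Qubits n} {i : Fin n} : i ∈ occupied s ↔ s i = 1 := by
  simp [occupied]

/-- The bijection between bit strings and sets of qubits given by `occupied`. -/
def occupiedEquiv (n : ℕ) : Qubits n ≃ Finset (Fin n) where
  toFun := occupied
  invFun S i := if i ∈ S then 1 else 0
  left_inv s := by
    ext i
    have := Fin.exists_fin_two.1 ⟨s i, rfl⟩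
    simp only [mem_occupied]
    grind
  right_inv S := by
    ext i
    simp [mem_occupied]

theorem occupied_injective : Function.Injective (occupied (n := n)) :=
  (occupiedEquiv n).injective

theorem occupied_occupiedEquiv_symm (S : Finset (Fin n)) :
    occupied ((occupiedEquiv n).symm S) = S :=
  (occupiedEquiv n).apply_symm_apply S

theorem compoundMatrix_apply_of_card (A : Matrix (Fin n) (Fin n) ℂ) {s t : Qubits n}
    {k : ℕ} (hs : (occupied s).card = k) (ht : (occupied t).card = k) :
    compoundMatrix A s t =
      (A.submatrix ((occupied s).orderEmbOfFin hs) ((occupied t).orderEmbOfFin ht)).det := by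
  subst hs
  simp [compoundMatrix, ht]

theorem compoundMatrix_apply_of_card_ne (A : Matrix (Fin n) (Fin n) ℂ) {s t : Qubits n}
    (h : (occupied t).card ≠ (occupied s).card) : compoundMatrix A s t = 0 := by
  simp [compoundMatrix, h]

/-- The `k`-th compound of `A`: the matrix of the map that `A` induces on the `k`-th exterior
power, in the basis of the wedge products of basis vectors. -/
noncomputable def exteriorPowerMatrix (k : ℕ) (A : Matrix (Fin n) (Fin n) ℂ) :
    Matrix (Set.powersetCard (Fin n) k) (Set.powersetCard (Fin n) k) ℂ :=
  LinearMap.toMatrix ((Pi.basisFun ℂ (Fin n)).exteriorPower k)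
    ((Pi.basisFun ℂ (Fin n)).exteriorPower k) (exteriorPower.map k (Matrix.toLin' A))

theorem exteriorPowerMatrix_mul (k : ℕ) (A B : Matrix (Fin n) (Fin n) ℂ) :
    exteriorPowerMatrix k (A * B) = exteriorPowerMatrix k A * exteriorPowerMatrix k B := by
  unfold exteriorPowerMatrix
  rw [Matrix.toLin'_mul, ← LinearMap.toMatrix_comp, exteriorPower.map_comp]

theorem exteriorPowerMatrix_apply (k : ℕ) (A : Matrix (Fin n) (Fin n) ℂ)
    (S T : Set.powersetCard (Fin n) k) :
    exteriorPowerMatrix k A S T =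
      (A.submatrix (S.1.orderEmbOfFin S.2) (T.1.orderEmbOfFin T.2)).det := by
  unfold exteriorPowerMatrix
  rw [LinearMap.toMatrix_apply, exteriorPower.basis_apply, exteriorPower.basis_repr_apply,
    exteriorPower.ιMulti_family, exteriorPower.map_apply_ιMulti,
    exteriorPower.ιMultiDual_apply_ιMulti, ← Matrix.det_transpose]
  congr 1
  ext i j
  simp [Set.powersetCard.ofFinEmbEquiv_symm_apply]

theorem compoundMatrix_apply_eq_exteriorPowerMatrix (A : Matrix (Fin n) (Fin n) ℂ)
    {s t : Qubits n} {k : ℕ} (hs : (occupied s).card = k) (ht : (occupied t).card = k) :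
    compoundMatrix A s t = exteriorPowerMatrix k A ⟨occupied s, hs⟩ ⟨occupied t, ht⟩ := by
  rw [compoundMatrix_apply_of_card A hs ht, exteriorPowerMatrix_apply]

/-- **Cauchy–Binet**. -/
theorem compoundMatrix_mul (A B : Matrix (Fin n) (Fin n) ℂ) :
    compoundMatrix (A * B) = compoundMatrix A * compoundMatrix B := by
  ext s t
  rw [Matrix.mul_apply]
  by_cases h : (occupied t).card = (occupied s).card
  · rw [compoundMatrix_apply_eq_exteriorPowerMatrix _ rfl h, exteriorPowerMatrix_mul,
      Matrix.mul_apply]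
    refine Fintype.sum_of_injective (fun S => (occupiedEquiv n).symm S.1)
      (fun S T hST => Subtype.ext ((occupiedEquiv n).symm.injective hST)) _ _ (fun u hu => ?_)
      fun S => ?_
    · rw [compoundMatrix_apply_of_card_ne A, zero_mul]
      exact fun hc => hu ⟨⟨occupied u, hc⟩, (occupiedEquiv n).symm_apply_apply u⟩
    · have hS : (occupied ((occupiedEquiv n).symm S.1)).card = (occupied s).card := by
        rw [occupied_occupiedEquiv_symm]
        exact S.2
      rw [compoundMatrix_apply_eq_exteriorPowerMatrix A rfl hS,
        compoundMatrix_apply_eq_exteriorPowerMatrix B hS h]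
      simp only [occupied_occupiedEquiv_symm]
  · rw [compoundMatrix_apply_of_card_ne _ h]
    refine (Finset.sum_eq_zero fun u _ => ?_).symm
    by_cases hu : (occupied u).card = (occupied s).card
    · rw [compoundMatrix_apply_of_card_ne B (by rwa [hu]), mul_zero]
    · rw [compoundMatrix_apply_of_card_ne A hu, zero_mul]

theorem compoundMatrix_transpose (A : Matrix (Fin n) (Fin n) ℂ) :
    compoundMatrix A.transpose = (compoundMatrix A).transpose := by
  ext s t
  rw [Matrix.transpose_apply]
  by_cases h : (occupied t).card = (occupied s).card
  · rw [compoundMatrix_apply_of_card _ rfl h, compoundMatrix_apply_of_card _ h rfl,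
      ← Matrix.det_transpose, Matrix.transpose_submatrix, Matrix.transpose_transpose]
  · rw [compoundMatrix_apply_of_card_ne _ h, compoundMatrix_apply_of_card_ne _ (Ne.symm h)]

theorem compoundMatrix_map_star (A : Matrix (Fin n) (Fin n) ℂ) :
    compoundMatrix (A.map star) = (compoundMatrix A).map star := by
  ext s t
  rw [Matrix.map_apply]
  by_cases h : (occupied t).card = (occupied s).card
  · rw [compoundMatrix_apply_of_card _ rfl h, compoundMatrix_apply_of_card _ rfl h]
    exact (RingHom.map_det (starRingEnd ℂ) _).symm
  · rw [compoundMatrix_apply_of_card_ne _ h, compoundMatrix_apply_of_card_ne _ h, star_zero]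

theorem compoundMatrix_conjTranspose (A : Matrix (Fin n) (Fin n) ℂ) :
    compoundMatrix A.conjTranspose = (compoundMatrix A).conjTranspose := by
  rw [Matrix.conjTranspose, compoundMatrix_map_star, compoundMatrix_transpose]
  rfl

theorem compoundMatrix_diagonal_apply_of_ne (d : Fin n → ℂ) {s t : Qubits n} (hst : s ≠ t) :
    compoundMatrix (Matrix.diagonal d) s t = 0 := by
  by_cases h : (occupied t).card = (occupied s).card
  · obtain ⟨i, hit, his⟩ : ∃ i ∈ occupied t, i ∉ occupied s := Finset.not_subset.1 fun hsub =>
      hst (occupied_injective (Finset.eq_of_subset_of_card_le hsub h.ge).symm)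
    obtain ⟨c, hc⟩ : i ∈ Set.range ((occupied t).orderEmbOfFin h) := by
      rwa [Finset.range_orderEmbOfFin]
    rw [compoundMatrix_apply_of_card _ rfl h]
    refine Matrix.det_eq_zero_of_column_eq_zero c fun r => ?_
    rw [Matrix.submatrix_apply, hc]
    refine Matrix.diagonal_apply_ne _ fun hr => his ?_
    rw [← hr]
    exact Finset.orderEmbOfFin_mem _ _ _
  · exact compoundMatrix_apply_of_card_ne _ h

theorem compoundMatrix_diagonal (d : Fin n → ℂ) :
    compoundMatrix (Matrix.diagonal d) = Matrix.diagonal fun s => ∏ i ∈ occupied s, d i := by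
  ext s t
  by_cases hst : s = t
  · subst hst
    rw [compoundMatrix_apply_of_card _ rfl rfl,
      Matrix.submatrix_diagonal _ _ ((occupied s).orderEmbOfFin rfl).injective,
      Matrix.det_diagonal, Matrix.diagonal_apply_eq]
    have h := Finset.prod_map Finset.univ ((occupied s).orderEmbOfFin rfl).toEmbedding d
    rw [Finset.map_orderEmbOfFin_univ] at h
    exact h.symm
  · rw [compoundMatrix_diagonal_apply_of_ne d hst, Matrix.diagonal_apply_ne _ hst]

theorem compoundMatrix_one : compoundMatrix (1 : Matrix (Fin n) (Fin n) ℂ) = 1 := by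
  rw [← Matrix.diagonal_one, compoundMatrix_diagonal]
  simp

end Compound

section Differential

open scoped Matrix.Norms.Operator

theorem hasDerivAt_matrix {m p : Type*} [Finite m] [Finite p] {X : ℝ → Matrix m p ℂ}
    {X' : Matrix m p ℂ} {τ : ℝ} :
    HasDerivAt X X' τ ↔ ∀ i j, HasDerivAt (fun x => X x i j) (X' i j) τ := by
  have := Fintype.ofFinite m
  have := Fintype.ofFinite p
  exact hasDerivAt_pi.trans (forall_congr' fun _ => hasDerivAt_pi)

variable {n : ℕ}

theorem differentiable_compoundMatrix : Differentiable ℂ (compoundMatrix (n := n)) := by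
  refine differentiable_pi.2 fun s => differentiable_pi.2 fun t => ?_
  by_cases hc : (occupied t).card = (occupied s).card
  · simp only [compoundMatrix_apply_of_card _ rfl hc, Matrix.det_apply', Matrix.submatrix_apply]
    fun_prop
  · simp only [compoundMatrix_apply_of_card_ne _ hc]
    fun_prop

theorem hasDerivAt_compoundMatrix_fderiv {X : ℝ → Matrix (Fin n) (Fin n) ℂ}
    {h : Matrix (Fin n) (Fin n) ℂ} (hX : HasDerivAt X h 0) (h0 : X 0 = 1) :
    HasDerivAt (fun x => compoundMatrix (X x)) (fderiv ℂ compoundMatrix 1 h) 0 := by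
  have hd : HasFDerivAt compoundMatrix
      ((fderiv ℂ compoundMatrix (1 : Matrix (Fin n) (Fin n) ℂ)).restrictScalars ℝ) (X 0) := by
    rw [h0]
    exact (differentiable_compoundMatrix 1).hasFDerivAt.restrictScalars ℝ
  exact hd.comp_hasDerivAt (0 : ℝ) hX

theorem hasDerivAt_exp_smul_zero (h : Matrix (Fin n) (Fin n) ℂ) :
    HasDerivAt (fun x : ℝ => NormedSpace.exp (x • h)) h 0 := by
  have hd := hasDerivAt_exp_smul_const (𝕂 := ℝ) h (0 : ℝ)
  rw [zero_smul, NormedSpace.exp_zero, one_mul] at hd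
  exact hd

theorem compoundDifferential_eq_fderiv (h : Matrix (Fin n) (Fin n) ℂ) :
    compoundDifferential h = fderiv ℂ compoundMatrix 1 h := by
  ext s t
  have hd := hasDerivAt_compoundMatrix_fderiv (hasDerivAt_exp_smul_zero h) (by simp)
  exact (hasDerivAt_matrix.1 hd s t).deriv

theorem compoundDifferential_add (A B : Matrix (Fin n) (Fin n) ℂ) :
    compoundDifferential (A + B) = compoundDifferential A + compoundDifferential B := by
  simp only [compoundDifferential_eq_fderiv, map_add]

theorem compoundDifferential_smul (a : ℂ) (A : Matrix (Fin n) (Fin n) ℂ) :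
    compoundDifferential (a • A) = a • compoundDifferential A := by
  simp only [compoundDifferential_eq_fderiv, map_smul]

theorem hasDerivAt_compoundMatrix {X : ℝ → Matrix (Fin n) (Fin n) ℂ}
    {h : Matrix (Fin n) (Fin n) ℂ} (hX : HasDerivAt X h 0) (h0 : X 0 = 1) :
    HasDerivAt (fun x => compoundMatrix (X x)) (compoundDifferential h) 0 := by
  rw [compoundDifferential_eq_fderiv]
  exact hasDerivAt_compoundMatrix_fderiv hX h0

theorem hasDerivAt_compoundMatrix_one_add_smul (h : Matrix (Fin n) (Fin n) ℂ) :
    HasDerivAt (fun x : ℝ => compoundMatrix (1 + x • h)) (compoundDifferential h) 0 := by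
  refine hasDerivAt_compoundMatrix ?_ (by simp)
  have hd := ((hasDerivAt_id (0 : ℝ)).smul_const h).const_add 1
  rw [one_smul] at hd
  exact hd

theorem compoundDifferential_transpose (A : Matrix (Fin n) (Fin n) ℂ) :
    compoundDifferential A.transpose = (compoundDifferential A).transpose := by
  refine (hasDerivAt_compoundMatrix_one_add_smul A.transpose).unique
    (hasDerivAt_matrix.2 fun s t => ?_)
  have h (x : ℝ) : compoundMatrix (1 + x • A.transpose) =
      (compoundMatrix (1 + x • A)).transpose := by
    rw [← compoundMatrix_transpose, Matrix.transpose_add, Matrix.transpose_smul,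
      Matrix.transpose_one]
  simp only [h, Matrix.transpose_apply]
  exact hasDerivAt_matrix.1 (hasDerivAt_compoundMatrix_one_add_smul A) t s

theorem compoundMatrix_mul_compoundDifferential_mul {P Q : Matrix (Fin n) (Fin n) ℂ}
    (hPQ : P * Q = 1) (A : Matrix (Fin n) (Fin n) ℂ) :
    compoundMatrix P * compoundDifferential A * compoundMatrix Q =
      compoundDifferential (P * A * Q) := by
  have hd := ((hasDerivAt_compoundMatrix_one_add_smul A).const_mul (compoundMatrix P)).mul_const
    (compoundMatrix Q)
  refine HasDerivAt.unique ?_ (hasDerivAt_compoundMatrix_one_add_smul (P * A * Q))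
  have h (x : ℝ) : compoundMatrix (1 + x • (P * A * Q)) =
      compoundMatrix P * compoundMatrix (1 + x • A) * compoundMatrix Q := by
    rw [← compoundMatrix_mul, ← compoundMatrix_mul, mul_add, add_mul, mul_one, hPQ, mul_smul_comm,
      smul_mul_assoc]
  simp only [h]
  exact hd

theorem exp_smul_mul_exp_smul_neg (h : Matrix (Fin n) (Fin n) ℂ) (x : ℝ) :
    NormedSpace.exp (x • h) * NormedSpace.exp (x • -h) = 1 := by
  rw [smul_neg, ← Matrix.exp_add_of_commute (x • h) (-(x • h)) (Commute.refl (x • h)).neg_right,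
    add_neg_cancel, NormedSpace.exp_zero]

theorem hasDerivAt_mul_mul_zero {m : Type*} [Fintype m] [DecidableEq m]
    {X Y : ℝ → Matrix m m ℂ} {h : Matrix m m ℂ} (hX : HasDerivAt X h 0) (hY : HasDerivAt Y (-h) 0)
    (hX0 : X 0 = 1) (hY0 : Y 0 = 1) (A : Matrix m m ℂ) :
    HasDerivAt (fun x => X x * A * Y x) (h * A - A * h) 0 := by
  have hd := (hX.mul_const A).mul hY
  simp only [hX0, hY0, one_mul, mul_one, mul_neg, ← sub_eq_add_neg] at hd
  exact hd

/-- Both sides are the derivative at `0` of `φ (exp (x h)) dφ(A) φ (exp (-x h))`. -/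
theorem compoundDifferential_lie (h A : Matrix (Fin n) (Fin n) ℂ) :
    compoundDifferential (h * A - A * h) =
      compoundDifferential h * compoundDifferential A -
        compoundDifferential A * compoundDifferential h := by
  have hp := hasDerivAt_exp_smul_zero h
  have hm := hasDerivAt_exp_smul_zero (-h)
  have hneg : compoundDifferential (-h) = -compoundDifferential h := by
    rw [← neg_one_smul ℂ h, compoundDifferential_smul, neg_one_smul]
  have hL := hasDerivAt_mul_mul_zero hp hm (by simp) (by simp) A
  have hR := hasDerivAt_mul_mul_zero (hasDerivAt_compoundMatrix hp (by simp))
    (hneg ▸ hasDerivAt_compoundMatrix hm (by simp)) (by simp [compoundMatrix_one])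
    (by simp [compoundMatrix_one]) (compoundDifferential A)
  simp only [compoundMatrix_mul_compoundDifferential_mul (exp_smul_mul_exp_smul_neg h _)] at hR
  simp only [compoundDifferential_eq_fderiv] at hR ⊢
  have hdL := ((fderiv ℂ compoundMatrix 1).restrictScalars ℝ).hasFDerivAt.comp_hasDerivAt (0 : ℝ) hL
  exact hdL.unique hR

theorem compoundDifferential_diagonal (c : Fin n → ℂ) :
    compoundDifferential (Matrix.diagonal c) = Matrix.diagonal fun s => ∑ i ∈ occupied s, c i := by
  refine (hasDerivAt_compoundMatrix_one_add_smul _).unique (hasDerivAt_matrix.2 fun s t => ?_)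
  have h (x : ℝ) : (1 : Matrix (Fin n) (Fin n) ℂ) + x • Matrix.diagonal c =
      Matrix.diagonal fun i => 1 + x • c i := by
    rw [← Matrix.diagonal_smul, ← Matrix.diagonal_one, Matrix.diagonal_add]
    rfl
  simp only [h, compoundMatrix_diagonal]
  obtain rfl | hst := eq_or_ne s t
  · simp only [Matrix.diagonal_apply_eq]
    have hprod := HasDerivAt.fun_finsetProd (u := occupied s) (f := fun i (x : ℝ) => 1 + x • c i)
      (f' := c) (x := (0 : ℝ)) fun i _ => by
        simpa using ((hasDerivAt_id (0 : ℝ)).smul_const (c i)).const_add 1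
    simpa using hprod
  · simp only [Matrix.diagonal_apply_ne _ hst]
    exact hasDerivAt_const _ _

theorem sum_smul_sigmaZ (c : Fin n → ℝ) :
    ∑ i, (c i : ℂ) • sigmaZ i = ((∑ i, c i : ℝ) : ℂ) • (1 : Matrix (Qubits n) (Qubits n) ℂ) -
      (2 : ℂ) • compoundDifferential (Matrix.diagonal fun i => (c i : ℂ)) := by
  rw [compoundDifferential_diagonal, ← Matrix.diagonal_one]
  ext s t
  simp only [sigmaZ, Matrix.sum_apply, Matrix.smul_apply, Matrix.sub_apply]
  obtain rfl | hst := eq_or_ne s t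
  · simp only [Matrix.diagonal_apply_eq, smul_eq_mul, occupied, Finset.sum_filter, Finset.mul_sum,
      Complex.ofReal_sum, Finset.sum_mul, ← Finset.sum_sub_distrib]
    refine Finset.sum_congr rfl fun i _ => ?_
    obtain h | h := Fin.exists_fin_two.1 ⟨s i, rfl⟩
    · simp [h]
    · simp only [h, one_ne_zero, if_false, if_true]
      ring
  · simp [Matrix.diagonal_apply_ne _ hst]

theorem compoundMatrix_zero_apply (A : Matrix (Fin n) (Fin n) ℂ) (t : Qubits n) :
    compoundMatrix A 0 t = (1 : Matrix (Qubits n) (Qubits n) ℂ) 0 t := by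
  have h0 : (occupied (0 : Qubits n)).card = 0 := by simp [occupied]
  rw [← compoundMatrix_one]
  by_cases ht : (occupied t).card = 0
  · rw [compoundMatrix_apply_of_card _ h0 ht, compoundMatrix_apply_of_card _ h0 ht,
      Matrix.det_isEmpty, Matrix.det_isEmpty]
  · rw [compoundMatrix_apply_of_card_ne _ (by rwa [h0]),
      compoundMatrix_apply_of_card_ne _ (by rwa [h0])]

theorem compoundDifferential_zero_apply (h : Matrix (Fin n) (Fin n) ℂ) (t : Qubits n) :
    compoundDifferential h 0 t = 0 := by
  have hd := hasDerivAt_matrix.1 (hasDerivAt_compoundMatrix_one_add_smul h) 0 t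
  simp only [compoundMatrix_zero_apply] at hd
  exact hd.unique (hasDerivAt_const _ _)

end Differential

section DLA

attribute [local instance] LieRing.ofAssociativeRing

/-- The Lie subalgebra of the operators `A` with `⟨0…0| A = 0`. It contains the dynamical Lie
algebra of the ansatz, because the ansatz acts trivially on `⋀⁰ ℂⁿ`. -/
def vacuumAnnihilator (n : ℕ) : LieSubalgebra ℝ (Matrix (Qubits n) (Qubits n) ℂ) where
  carrier := {A | ∀ t, A 0 t = 0}
  add_mem' hA hB t := by rw [Matrix.add_apply, hA t, hB t, add_zero]
  zero_mem' _ := rfl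
  smul_mem' a A hA t := by rw [Matrix.smul_apply, hA t, smul_zero]
  lie_mem' {A B} hA hB t := by
    rw [LieRing.of_associative_ring_bracket, Matrix.sub_apply, Matrix.mul_apply, Matrix.mul_apply,
      Finset.sum_eq_zero fun u _ => by rw [hA u, zero_mul],
      Finset.sum_eq_zero fun u _ => by rw [hB u, zero_mul], sub_zero]

theorem compoundDLA_subset_vacuumAnnihilator {n : ℕ} (S : Set (Matrix (Fin n) (Fin n) ℂ)) :
    compoundDLA S ⊆ vacuumAnnihilator n := by
  refine (LieSubalgebra.lieSpan_le (K := vacuumAnnihilator n)).2 ?_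
  rintro _ ⟨h, _, rfl⟩
  exact compoundDifferential_zero_apply h

theorem I_smul_sigmaZ_notMem_compoundDLA {n : ℕ} (S : Set (Matrix (Fin n) (Fin n) ℂ)) (i : Fin n) :
    Complex.I • sigmaZ i ∉ compoundDLA S := by
  intro hmem
  have h0 : (Complex.I • sigmaZ i) (0 : Qubits n) 0 = 0 :=
    compoundDLA_subset_vacuumAnnihilator S hmem 0
  simp [sigmaZ] at h0

end DLA

section Hop

variable {n : ℕ}

theorem det_submatrix_one_add_single {ι R : Type*} [DecidableEq ι] [CommRing R] {k : ℕ}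
    {e : Fin k → ι} (he : Function.Injective e) (f : Fin k → ι) (r : Fin k) (b : ι) (x : R) :
    ((1 + Matrix.single (e r) b x).submatrix e f).det =
      (Matrix.submatrix (1 : Matrix ι ι R) e f).det +
        x * (Matrix.submatrix (1 : Matrix ι ι R) (Function.update e r b) f).det := by
  have hsum : (1 + Matrix.single (e r) b x).submatrix e f =
      (Matrix.submatrix 1 e f).updateRow r
        (Matrix.submatrix 1 e f r + x • fun c => (1 : Matrix ι ι R) b (f c)) := by
    ext a c
    obtain rfl | ha := eq_or_ne a r
    · simp [Matrix.single_apply, Matrix.one_apply]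
    · simp [Matrix.updateRow_ne ha, Matrix.single_apply_of_row_ne (he.ne ha.symm)]
  have hrow : Matrix.submatrix (1 : Matrix ι ι R) (Function.update e r b) f =
      (Matrix.submatrix 1 e f).updateRow r fun c => (1 : Matrix ι ι R) b (f c) := by
    ext a c
    obtain rfl | ha := eq_or_ne a r
    · rw [Matrix.submatrix_apply, Matrix.updateRow_self, Function.update_self]
    · rw [Matrix.submatrix_apply, Matrix.updateRow_ne ha, Function.update_of_ne ha,
        Matrix.submatrix_apply]
  rw [hsum, hrow, Matrix.det_updateRow_add, Matrix.det_updateRow_smul, Matrix.updateRow_eq_self]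

theorem card_occupied_comp_perm (s : Qubits n) (σ : Equiv.Perm (Fin n)) :
    (occupied (s ∘ σ)).card = (occupied s).card := by
  refine Finset.card_bij (fun i _ => σ i) (fun i hi => ?_) (fun i _ j _ h => σ.injective h)
    fun i hi => ⟨σ.symm i, ?_, σ.apply_symm_apply i⟩
  · exact mem_occupied.2 (mem_occupied.1 hi :)
  · rw [mem_occupied, Function.comp_apply, σ.apply_symm_apply]
    exact mem_occupied.1 hi

theorem strictMonoOn_swap_of_covBy {a b : Fin n} (hab : a ⋖ b) :
    StrictMonoOn (Equiv.swap a b) {b}ᶜ := by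
  intro c hc d hd hcd
  have hc' : c ≠ b := hc
  have hd' : d ≠ b := hd
  have hlt := hab.lt
  have hbet := hab.2
  rw [Equiv.swap_apply_def, Equiv.swap_apply_def]
  grind

theorem orderEmbOfFin_occupied_comp_swap {a b : Fin n} (hab : a ⋖ b) {s : Qubits n}
    (hb : s b ≠ 1) {k : ℕ} (hs : (occupied s).card = k)
    (hs' : (occupied (s ∘ Equiv.swap a b)).card = k) :
    ⇑((occupied (s ∘ Equiv.swap a b)).orderEmbOfFin hs') =
      Equiv.swap a b ∘ (occupied s).orderEmbOfFin hs := by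
  have hmem (c : Fin k) : s ((occupied s).orderEmbOfFin hs c) = 1 :=
    mem_occupied.1 (Finset.orderEmbOfFin_mem _ hs c)
  refine (Finset.orderEmbOfFin_unique hs' (fun c => ?_) fun c d hcd => ?_).symm
  · rw [mem_occupied, Function.comp_apply, Function.comp_apply, Equiv.swap_apply_self, hmem]
  · have hne (c : Fin k) : (occupied s).orderEmbOfFin hs c ≠ b := fun h => hb (h ▸ hmem c)
    exact strictMonoOn_swap_of_covBy hab (hne c) (hne d)
      (((occupied s).orderEmbOfFin hs).strictMono hcd)

theorem compoundMatrix_one_add_single_of_ne {a : Fin n} {s : Qubits n} (ha : s a ≠ 1)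
    (b : Fin n) (x : ℂ) (t : Qubits n) :
    compoundMatrix (1 + Matrix.single a b x) s t = (1 : Matrix _ _ ℂ) s t := by
  rw [← compoundMatrix_one]
  by_cases hc : (occupied t).card = (occupied s).card
  · rw [compoundMatrix_apply_of_card _ rfl hc, compoundMatrix_apply_of_card _ rfl hc]
    congr 1
    ext c d
    have hne : a ≠ (occupied s).orderEmbOfFin rfl c := by
      rintro rfl
      exact ha (mem_occupied.1 (Finset.orderEmbOfFin_mem _ _ c))
    simp [Matrix.single_apply_of_row_ne hne]
  · rw [compoundMatrix_apply_of_card_ne _ hc, compoundMatrix_apply_of_card_ne _ hc]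

theorem exists_orderEmbOfFin_occupied {s : Qubits n} {i : Fin n} (hi : s i = 1) :
    ∃ r, (occupied s).orderEmbOfFin rfl r = i := by
  rw [← Set.mem_range, Finset.range_orderEmbOfFin]
  exact mem_occupied.2 hi

theorem swap_comp_eq_update {ι κ : Type*} [DecidableEq ι] [DecidableEq κ] {e : κ → ι}
    (he : Function.Injective e) (r : κ) {b : ι} (hb : ∀ c, e c ≠ b) :
    Equiv.swap (e r) b ∘ e = Function.update e r b := by
  ext c
  obtain rfl | hc := eq_or_ne c r
  · rw [Function.comp_apply, Equiv.swap_apply_left, Function.update_self]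
  · rw [Function.comp_apply, Equiv.swap_apply_of_ne_of_ne (he.ne hc) (hb c),
      Function.update_of_ne hc]

theorem det_submatrix_update_eq_zero {ι ι' κ R : Type*} [DecidableEq κ] [Fintype κ] [CommRing R]
    (M : Matrix ι ι' R) (e : κ → ι) (f : κ → ι') {r r' : κ} (h : r' ≠ r) :
    (M.submatrix (Function.update e r (e r')) f).det = 0 := by
  refine Matrix.det_zero_of_row_eq h ?_
  funext c
  rw [Matrix.submatrix_apply, Matrix.submatrix_apply, Function.update_of_ne h, Function.update_self]

theorem compoundMatrix_one_add_single {a b : Fin n} (hab : a ⋖ b) (s t : Qubits n) (x : ℂ) :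
    compoundMatrix (1 + Matrix.single a b x) s t = (1 : Matrix _ _ ℂ) s t +
      x * if s a = 1 ∧ s b ≠ 1 then (1 : Matrix _ _ ℂ) (s ∘ Equiv.swap a b) t else 0 := by
  by_cases ha : s a = 1
  swap
  · simp [compoundMatrix_one_add_single_of_ne ha, ha]
  have hcard := card_occupied_comp_perm s (Equiv.swap a b)
  rw [← compoundMatrix_one]
  by_cases hc : (occupied t).card = (occupied s).card
  swap
  · simp [compoundMatrix_apply_of_card_ne _ hc, compoundMatrix_apply_of_card_ne _ (hcard ▸ hc)]
  obtain ⟨r, rfl⟩ := exists_orderEmbOfFin_occupied ha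
  rw [compoundMatrix_apply_of_card _ rfl hc, compoundMatrix_apply_of_card _ rfl hc,
    det_submatrix_one_add_single (RelEmbedding.injective _)]
  congr 2
  by_cases hb : s b = 1
  · obtain ⟨r', rfl⟩ := exists_orderEmbOfFin_occupied hb
    rw [if_neg (by simp [hb])]
    exact det_submatrix_update_eq_zero _ _ _ fun h => hab.ne (congrArg _ h.symm)
  · have hne (c) : (occupied s).orderEmbOfFin rfl c ≠ b := fun h =>
      hb (h ▸ mem_occupied.1 (Finset.orderEmbOfFin_mem _ rfl c))
    rw [if_pos ⟨ha, hb⟩, compoundMatrix_apply_of_card _ hcard hc,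
      orderEmbOfFin_occupied_comp_swap hab hb rfl hcard,
      swap_comp_eq_update (RelEmbedding.injective _) r hne]

theorem compoundDifferential_single {a b : Fin n} (hab : a ⋖ b) (s t : Qubits n) :
    compoundDifferential (Matrix.single a b 1) s t =
      if s a = 1 ∧ s b ≠ 1 then (1 : Matrix _ _ ℂ) (s ∘ Equiv.swap a b) t else 0 := by
  have hd := hasDerivAt_matrix.1
    (hasDerivAt_compoundMatrix_one_add_smul (Matrix.single a b 1)) s t
  have hx (x : ℝ) : x • Matrix.single a b (1 : ℂ) = Matrix.single a b (x : ℂ) := by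
    rw [Matrix.smul_single, Complex.real_smul, mul_one]
  simp only [hx, compoundMatrix_one_add_single hab] at hd
  have hlin (z w : ℂ) : HasDerivAt (fun x : ℝ => z + x * w) w 0 := by
    simpa using ((hasDerivAt_id (0 : ℝ)).ofReal_comp.mul_const w).const_add z
  exact hd.unique (hlin _ _)

theorem four_mul_card_filter {a b : Fin n} (hab : a ≠ b) :
    4 * (Finset.univ.filter fun s : Qubits n => s a = 1 ∧ s b ≠ 1).card = 2 ^ n := by
  have hpi : (Finset.univ.filter fun s : Qubits n => s a = 1 ∧ s b ≠ 1) =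
      Fintype.piFinset fun i => if i = a then {1} else if i = b then {0} else Finset.univ := by
    ext s
    have hs := Fin.exists_fin_two.1 ⟨s b, rfl⟩
    simp only [Finset.mem_filter, Finset.mem_univ, true_and, Fintype.mem_piFinset]
    refine ⟨fun h i => ?_, fun h => ⟨by simpa using h a, ?_⟩⟩
    · grind
    · have := h b
      simp_all [hab.symm]
  have hfree : ∏ i ∈ ({a, b} : Finset (Fin n))ᶜ, (if i = a then {1} else if i = b then {0} else
      Finset.univ : Finset (Fin 2)).card = 2 ^ (n - 2) := by
    rw [Finset.prod_congr rfl (g := fun _ => 2), Finset.prod_const, Finset.card_compl,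
      Finset.card_pair hab, Fintype.card_fin]
    intro i hi
    simp_all
  have hn : 2 ≤ n := by simpa [hab] using Finset.card_le_univ ({a, b} : Finset (Fin n))
  rw [hpi, Fintype.card_piFinset, ← Finset.prod_mul_prod_compl {a, b}, hfree,
    Finset.prod_pair hab, if_pos rfl, if_neg hab.symm, if_pos rfl, Finset.card_singleton,
    Finset.card_singleton, one_mul, one_mul]
  exact pow_mul_pow_sub 2 hn

theorem four_mul_sum_compoundDifferential_single {a b : Fin n} (hab : a ⋖ b) :
    4 * ∑ s, ∑ t, compoundDifferential (Matrix.single a b 1) s t = 2 ^ n := by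
  have hrow (s : Qubits n) : ∑ t, compoundDifferential (Matrix.single a b 1) s t =
      if s a = 1 ∧ s b ≠ 1 then 1 else 0 := by
    simp only [compoundDifferential_single hab]
    split_ifs <;> simp [Matrix.one_apply]
  simp only [hrow]
  rw [Finset.sum_boole]
  exact_mod_cast four_mul_card_filter hab.ne

theorem two_mul_sum_compoundDifferential_single_add {a b : Fin n} (hab : a ⋖ b) :
    2 * ∑ s, ∑ t, compoundDifferential (Matrix.single a b 1 + Matrix.single b a 1) s t = 2 ^ n := by
  have hT : Matrix.single b a (1 : ℂ) = (Matrix.single a b 1).transpose := by simp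
  rw [hT, compoundDifferential_add, compoundDifferential_transpose]
  simp only [Matrix.add_apply, Matrix.transpose_apply, Finset.sum_add_distrib]
  rw [Finset.sum_comm (f := fun s t => compoundDifferential (Matrix.single a b 1) t s),
    ← four_mul_sum_compoundDifferential_single hab]
  ring

end Hop

section HaarProb

variable (G : Type*) [Group G] [TopologicalSpace G] [IsTopologicalGroup G]
    [CompactSpace G] [MeasurableSpace G] [BorelSpace G]

instance isHaarMeasure_haarProb : (haarProb G).IsHaarMeasure :=
  Measure.isHaarMeasure_haarMeasure _

instance isProbabilityMeasure_haarProb : IsProbabilityMeasure (haarProb G) :=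
  ⟨by simpa [haarProb] using Measure.haarMeasure_self (G := G) (K₀ := ⊤)⟩

-- A right translate of a Haar probability measure is again one, hence equal to it.
instance isMulRightInvariant_haarProb : (haarProb G).IsMulRightInvariant where
  map_mul_right_eq_self g :=
    have := Measure.isHaarMeasure_map_mul_right (haarProb G) g
    have := Measure.isProbabilityMeasure_map (μ := haarProb G) (measurable_mul_const g).aemeasurable
    Measure.isHaarMeasure_eq_of_isProbabilityMeasure _ _

variable {G}

theorem integrable_haarProb_of_continuous {f : G → ℝ} (hf : Continuous f) :
    Integrable f (haarProb G) :=
  hf.integrable_of_hasCompactSupport (HasCompactSupport.of_compactSpace f)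

end HaarProb

section CentredSum

theorem sum_mul_mul_eq_of_perm_invariant {ι : Type*} [Fintype ι] {f : ι → ι → ℝ}
    (hf : ∀ (σ : Equiv.Perm ι) i k, f (σ i) (σ k) = f i k) {o p : ι} (hop : o ≠ p)
    {β : ι → ℝ} (hβ : ∑ i, β i = 0) :
    ∑ i, ∑ k, β i * β k * f i k = (f o o - f o p) * ∑ i, β i ^ 2 := by
  classical
  have hoff : ∀ {i k}, i ≠ k → f i k = f o p := by
    intro i k hik
    obtain ⟨σ, rfl, rfl⟩ :=
      MulAction.is_two_pretransitive_iff.1 (Equiv.Perm.isMultiplyPretransitive ι 2) hop hik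
    exact hf σ o p
  have hdiag : ∀ i, f i i = f o o := fun i => by
    simpa using hf (Equiv.swap o i) o o
  have hsplit : ∀ i k, β i * β k * f i k =
      β i * f o p * β k + if i = k then (f o o - f o p) * (β i * β k) else 0 := by
    intro i k
    split_ifs with hik
    · rw [← hik, hdiag]; ring
    · rw [hoff hik]; ring
  simp only [hsplit, Finset.sum_add_distrib, ← Finset.mul_sum, hβ, Finset.sum_ite_eq,
    Finset.mem_univ, if_true, mul_zero, zero_add, sq]

end CentredSum

section EntrySq

variable {n : ℕ} {𝕜 : Type*} [RCLike 𝕜]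

theorem exists_diagonal_mem_specialUnitaryGroup [NeZero n] {u : Matrix (Fin n) (Fin n) 𝕜}
    (hu : u ∈ Matrix.unitaryGroup (Fin n) 𝕜) :
    ∃ d : Fin n → 𝕜, (∀ i, ‖d i‖ = 1) ∧
      u * Matrix.diagonal d ∈ Matrix.specialUnitaryGroup (Fin n) 𝕜 ∧
      Matrix.diagonal d * u ∈ Matrix.specialUnitaryGroup (Fin n) 𝕜 := by
  have hdet : u.det ∈ unitary 𝕜 := Matrix.det_of_mem_unitary hu
  let d : Fin n → 𝕜 := Function.update 1 0 (star u.det)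
  have hd : ∀ i, ‖d i‖ = 1 := by
    intro i
    obtain rfl | hi := eq_or_ne i 0
    · simp [d, CStarRing.norm_of_mem_unitary hdet]
    · simp [d, hi]
  have hd_mem : Matrix.diagonal d ∈ Matrix.unitaryGroup (Fin n) 𝕜 := by
    rw [Matrix.mem_unitaryGroup_iff, Matrix.star_eq_conjTranspose, Matrix.diagonal_conjTranspose,
      Matrix.diagonal_mul_diagonal, ← Matrix.diagonal_one]
    congr 1
    funext i
    simp [RCLike.mul_conj, hd i]
  have hd_det : (Matrix.diagonal d).det = star u.det := by
    rw [Matrix.det_diagonal, Finset.prod_update_of_mem (Finset.mem_univ _)]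
    simp
  refine ⟨d, hd, Matrix.mem_specialUnitaryGroup_iff.2 ⟨mul_mem hu hd_mem, ?_⟩,
    Matrix.mem_specialUnitaryGroup_iff.2 ⟨mul_mem hd_mem hu, ?_⟩⟩
  · rw [Matrix.det_mul, hd_det, Unitary.mul_star_self_of_mem hdet]
  · rw [Matrix.det_mul, hd_det, Unitary.star_mul_self_of_mem hdet]

/-- The squared moduli of the entries of a matrix. They are unchanged by diagonal phases, so their
distribution on `SU(n)` and `SO(n)` is invariant under translation by all unitary matrices. -/
def entrySq (A : Matrix (Fin n) (Fin n) 𝕜) : Fin n → Fin n → ℝ := fun i j => ‖A i j‖ ^ 2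

theorem continuous_entrySq (i j : Fin n) :
    Continuous fun g : Matrix.specialUnitaryGroup (Fin n) 𝕜 => entrySq (g : Matrix _ _ 𝕜) i j :=
  (continuous_subtype_val.matrix_elem i j).norm.pow 2

theorem integrable_entrySq_mul (i j k l : Fin n) :
    Integrable (fun g : Matrix.specialUnitaryGroup (Fin n) 𝕜 =>
      entrySq (g : Matrix _ _ 𝕜) i j * entrySq (g : Matrix _ _ 𝕜) k l) (haarProb _) :=
  integrable_haarProb_of_continuous ((continuous_entrySq i j).mul (continuous_entrySq k l))

theorem integral_entrySq_mul_mul [NeZero n] {u v : Matrix (Fin n) (Fin n) 𝕜}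
    (hv : v ∈ Matrix.unitaryGroup (Fin n) 𝕜) (hu : u ∈ Matrix.unitaryGroup (Fin n) 𝕜)
    (F : (Fin n → Fin n → ℝ) → ℝ) :
    ∫ g : Matrix.specialUnitaryGroup (Fin n) 𝕜, F (entrySq (v * (g : Matrix _ _ 𝕜) * u))
        ∂haarProb _ =
      ∫ g : Matrix.specialUnitaryGroup (Fin n) 𝕜, F (entrySq (g : Matrix _ _ 𝕜)) ∂haarProb _ := by
  obtain ⟨d, hd, -, hdv⟩ := exists_diagonal_mem_specialUnitaryGroup hv
  obtain ⟨e, he, hue, -⟩ := exists_diagonal_mem_specialUnitaryGroup hu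
  let v' : Matrix.specialUnitaryGroup (Fin n) 𝕜 := ⟨_, hdv⟩
  let u' : Matrix.specialUnitaryGroup (Fin n) 𝕜 := ⟨_, hue⟩
  refine Eq.trans ?_ ((integral_mul_right_eq_self
      (fun g : Matrix.specialUnitaryGroup (Fin n) 𝕜 =>
        F (entrySq ((v' * g : Matrix.specialUnitaryGroup (Fin n) 𝕜) : Matrix _ _ 𝕜))) u').trans
    (integral_mul_left_eq_self (fun g : Matrix.specialUnitaryGroup (Fin n) 𝕜 =>
      F (entrySq (g : Matrix _ _ 𝕜))) v'))
  refine integral_congr_ae (Filter.Eventually.of_forall fun g => congrArg F ?_)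
  have hphase : (v' * (g * u') : Matrix (Fin n) (Fin n) 𝕜) =
      Matrix.diagonal d * (v * g * u) * Matrix.diagonal e := by simp only [v', u', mul_assoc]
  funext i j
  simp only [entrySq, Submonoid.coe_mul, hphase, Matrix.mul_diagonal, Matrix.diagonal_mul,
    norm_mul, hd, he, one_mul, mul_one]

theorem permMatrix_mem_unitaryGroup (σ : Equiv.Perm (Fin n)) :
    σ.permMatrix 𝕜 ∈ Matrix.unitaryGroup (Fin n) 𝕜 := by
  rw [Matrix.mem_unitaryGroup_iff, Matrix.star_eq_conjTranspose, Matrix.conjTranspose_permMatrix,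
    ← Matrix.permMatrix_mul, inv_mul_cancel, Matrix.permMatrix_one]

theorem integral_entrySq_perm [NeZero n] (σ τ : Equiv.Perm (Fin n))
    (F : (Fin n → Fin n → ℝ) → ℝ) :
    ∫ g : Matrix.specialUnitaryGroup (Fin n) 𝕜,
        F (fun i j => entrySq (g : Matrix _ _ 𝕜) (σ i) (τ j)) ∂haarProb _ =
      ∫ g : Matrix.specialUnitaryGroup (Fin n) 𝕜, F (entrySq (g : Matrix _ _ 𝕜)) ∂haarProb _ := by
  rw [← integral_entrySq_mul_mul (permMatrix_mem_unitaryGroup σ)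
    (permMatrix_mem_unitaryGroup τ.symm) F]
  refine integral_congr_ae (Filter.Eventually.of_forall fun g => congrArg F ?_)
  funext i j
  simp [entrySq, Equiv.Perm.permMatrix, PEquiv.toMatrix_toPEquiv_mul,
    PEquiv.mul_toMatrix_toPEquiv]

variable (𝕜) in
/-- The second moments `𝔼 |gᵢⱼ|² |gₖₗ|²` of the squared moduli of the entries of a Haar random
group element. -/
noncomputable def entryMoment (i j k l : Fin n) : ℝ :=
  ∫ g : Matrix.specialUnitaryGroup (Fin n) 𝕜,
    entrySq (g : Matrix _ _ 𝕜) i j * entrySq (g : Matrix _ _ 𝕜) k l ∂haarProb _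

theorem entryMoment_perm [NeZero n] (σ τ : Equiv.Perm (Fin n)) (i j k l : Fin n) :
    entryMoment 𝕜 (σ i) (τ j) (σ k) (τ l) = entryMoment 𝕜 i j k l :=
  integral_entrySq_perm σ τ fun p => p i j * p k l

theorem integral_entrySq_eq [NeZero n] (i j k l : Fin n) :
    ∫ g : Matrix.specialUnitaryGroup (Fin n) 𝕜, entrySq (g : Matrix _ _ 𝕜) i j ∂haarProb _ =
      ∫ g : Matrix.specialUnitaryGroup (Fin n) 𝕜, entrySq (g : Matrix _ _ 𝕜) k l ∂haarProb _ := by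
  simpa using integral_entrySq_perm (𝕜 := 𝕜) (Equiv.swap k i) (Equiv.swap l j) fun p => p k l

theorem integral_bilinear_entrySq [NeZero n] {α : Fin n → ℝ} (β : Fin n → ℝ)
    (hα : ∑ j, α j = 0) :
    ∫ g : Matrix.specialUnitaryGroup (Fin n) 𝕜,
      (∑ i, ∑ j, β i * α j * entrySq (g : Matrix _ _ 𝕜) i j) ∂haarProb _ = 0 := by
  have hint : ∀ i j, Integrable (fun g : Matrix.specialUnitaryGroup (Fin n) 𝕜 =>
      β i * α j * entrySq (g : Matrix _ _ 𝕜) i j) (haarProb _) := fun i j =>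
    (integrable_haarProb_of_continuous (continuous_entrySq i j)).const_mul _
  rw [integral_finsetSum _ fun i _ => integrable_finsetSum _ fun j _ => hint i j]
  simp only [integral_finsetSum _ fun j _ => hint _ j, integral_const_mul,
    integral_entrySq_eq _ _ 0 0, ← Finset.sum_mul, ← Finset.mul_sum, hα, mul_zero, zero_mul,
    Finset.sum_const_zero]

theorem integral_bilinear_entrySq_sq (α β : Fin n → ℝ) :
    ∫ g : Matrix.specialUnitaryGroup (Fin n) 𝕜,
      (∑ i, ∑ j, β i * α j * entrySq (g : Matrix _ _ 𝕜) i j) ^ 2 ∂haarProb _ =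
      ∑ i, ∑ k, β i * β k * ∑ j, ∑ l, α j * α l * entryMoment 𝕜 i j k l := by
  have hsq : ∀ g : Matrix.specialUnitaryGroup (Fin n) 𝕜,
      (∑ i, ∑ j, β i * α j * entrySq (g : Matrix _ _ 𝕜) i j) ^ 2 =
      ∑ i, ∑ k, ∑ j, ∑ l, β i * β k * (α j * α l) *
        (entrySq (g : Matrix _ _ 𝕜) i j * entrySq (g : Matrix _ _ 𝕜) k l) := by
    intro g
    rw [sq, Finset.sum_mul_sum]
    simp only [Finset.sum_mul_sum]
    refine Finset.sum_congr rfl fun i _ => Finset.sum_congr rfl fun k _ =>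
      Finset.sum_congr rfl fun j _ => Finset.sum_congr rfl fun l _ => by ring
  have hint : ∀ i k j l, Integrable (fun g : Matrix.specialUnitaryGroup (Fin n) 𝕜 =>
      β i * β k * (α j * α l) *
        (entrySq (g : Matrix _ _ 𝕜) i j * entrySq (g : Matrix _ _ 𝕜) k l)) (haarProb _) :=
    fun i k j l => (integrable_entrySq_mul i j k l).const_mul _
  simp only [hsq]
  rw [integral_finsetSum _ fun i _ => integrable_finsetSum _ fun k _ =>
    integrable_finsetSum _ fun j _ => integrable_finsetSum _ fun l _ => hint i k j l]
  refine Finset.sum_congr rfl fun i _ => ?_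
  rw [integral_finsetSum _ fun k _ =>
    integrable_finsetSum _ fun j _ => integrable_finsetSum _ fun l _ => hint i k j l]
  refine Finset.sum_congr rfl fun k _ => ?_
  rw [integral_finsetSum _ fun j _ => integrable_finsetSum _ fun l _ => hint i k j l,
    Finset.mul_sum]
  refine Finset.sum_congr rfl fun j _ => ?_
  rw [integral_finsetSum _ fun l _ => hint i k j l, Finset.mul_sum]
  refine Finset.sum_congr rfl fun l _ => ?_
  rw [integral_const_mul, entryMoment, mul_assoc]

theorem exists_integral_bilinear_entrySq_sq (n : ℕ) [Nontrivial (Fin n)] (𝕜 : Type*) [RCLike 𝕜] :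
    ∃ e : ℝ, ∀ α β : Fin n → ℝ, ∑ i, α i = 0 → ∑ i, β i = 0 →
      ∫ g : Matrix.specialUnitaryGroup (Fin n) 𝕜,
        (∑ i, ∑ j, β i * α j * entrySq (g : Matrix _ _ 𝕜) i j) ^ 2 ∂haarProb _ =
      e * (∑ i, α i ^ 2) * (∑ i, β i ^ 2) := by
  obtain ⟨o, p, hop⟩ := exists_pair_ne (Fin n)
  have : NeZero n := ⟨Fin.pos_iff_nonempty.2 ⟨o⟩ |>.ne'⟩
  refine ⟨(entryMoment 𝕜 o o o o - entryMoment 𝕜 o o o p) -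
    (entryMoment 𝕜 o o p o - entryMoment 𝕜 o o p p), fun α β hα hβ => ?_⟩
  have hcol : ∀ i k, ∑ j, ∑ l, α j * α l * entryMoment 𝕜 i j k l =
      (entryMoment 𝕜 i o k o - entryMoment 𝕜 i o k p) * ∑ j, α j ^ 2 := fun i k =>
    sum_mul_mul_eq_of_perm_invariant
      (fun τ j l => entryMoment_perm (Equiv.refl _) τ i j k l) hop hα
  have hrow := sum_mul_mul_eq_of_perm_invariant
    (f := fun i k => ∑ j, ∑ l, α j * α l * entryMoment 𝕜 i j k l) (fun σ i k => by
      simpa using congrArg (fun f : Fin n → Fin n → ℝ => ∑ j, ∑ l, α j * α l * f j l)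
        (funext fun j => funext fun l => entryMoment_perm σ (Equiv.refl _) i j k l)) hop hβ
  rw [integral_bilinear_entrySq_sq, hrow, hcol, hcol]
  ring

end EntrySq

section Frobenius

variable {ι 𝕜 : Type*} [Fintype ι] [RCLike 𝕜]

/-- The squared Frobenius norm of a matrix. -/
def frobSq (A : Matrix ι ι 𝕜) : ℝ := ∑ i, ∑ j, ‖A i j‖ ^ 2

theorem frobSq_nonneg (A : Matrix ι ι 𝕜) : 0 ≤ frobSq A :=
  Finset.sum_nonneg fun _ _ => Finset.sum_nonneg fun _ _ => sq_nonneg _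

theorem frobSq_eq_re_trace_mul_conjTranspose (A : Matrix ι ι 𝕜) :
    frobSq A = RCLike.re (A * A.conjTranspose).trace := by
  simp only [frobSq, Matrix.trace, Matrix.diag, Matrix.mul_apply, map_sum,
    Matrix.conjTranspose_apply, RCLike.star_def, RCLike.mul_conj, ← RCLike.ofReal_pow,
    RCLike.ofReal_re]

theorem frobSq_eq_re_trace_mul_self {A : Matrix ι ι 𝕜} (hA : A.IsHermitian) :
    frobSq A = RCLike.re (A * A).trace := by
  rw [frobSq_eq_re_trace_mul_conjTranspose, hA.eq]

theorem eq_zero_of_frobSq_eq_zero {A : Matrix ι ι 𝕜} (hA : frobSq A = 0) : A = 0 := by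
  have hrow := (Finset.sum_eq_zero_iff_of_nonneg fun _ _ =>
    Finset.sum_nonneg fun _ _ => sq_nonneg _).1 hA
  ext i j
  have hij := (Finset.sum_eq_zero_iff_of_nonneg fun _ _ => sq_nonneg _).1
    (hrow i (Finset.mem_univ i)) j (Finset.mem_univ j)
  simpa using hij

theorem sq_re_trace_mul_le (A B : Matrix ι ι 𝕜) :
    RCLike.re (A * B).trace ^ 2 ≤ frobSq A * frobSq B := by
  have habs : |RCLike.re (A * B).trace| ≤ ∑ p : ι × ι, ‖A p.1 p.2‖ * ‖B p.2 p.1‖ := by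
    rw [Fintype.sum_prod_type]
    exact (RCLike.abs_re_le_norm _).trans <| (norm_sum_le _ _).trans <| Finset.sum_le_sum fun i _ =>
      (norm_sum_le _ _).trans <| Finset.sum_le_sum fun j _ => norm_mul_le _ _
  have hcs := Finset.sum_mul_sq_le_sq_mul_sq Finset.univ
    (fun p : ι × ι => ‖A p.1 p.2‖) (fun p => ‖B p.2 p.1‖)
  rw [Fintype.sum_prod_type (fun p : ι × ι => ‖A p.1 p.2‖ ^ 2),
    Fintype.sum_prod_type_right (fun p : ι × ι => ‖B p.2 p.1‖ ^ 2)] at hcs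
  rw [← sq_abs]
  exact (pow_le_pow_left₀ (abs_nonneg _) habs 2).trans hcs

theorem frobSq_transpose (A : Matrix ι ι 𝕜) : frobSq A.transpose = frobSq A :=
  Finset.sum_comm

theorem continuous_frobSq : Continuous (frobSq : Matrix ι ι 𝕜 → ℝ) :=
  continuous_finsetSum _ fun i _ => continuous_finsetSum _ fun j _ =>
    (continuous_id.matrix_elem i j).norm.pow 2

variable [DecidableEq ι]

theorem frobSq_diagonal (d : ι → 𝕜) : frobSq (Matrix.diagonal d) = ∑ i, ‖d i‖ ^ 2 := by
  refine Finset.sum_congr rfl fun i _ => ?_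
  rw [Finset.sum_eq_single_of_mem i (Finset.mem_univ i) fun j _ hj => by
    simp [Matrix.diagonal_apply_ne _ hj.symm], Matrix.diagonal_apply_eq]

theorem frobSq_unitary_conj {u : Matrix ι ι 𝕜} (hu : u ∈ Matrix.unitaryGroup ι 𝕜)
    (A : Matrix ι ι 𝕜) : frobSq (u * A * u.conjTranspose) = frobSq A := by
  have huu : u.conjTranspose * u = 1 := Matrix.mem_unitaryGroup_iff'.1 hu
  rw [frobSq_eq_re_trace_mul_conjTranspose, frobSq_eq_re_trace_mul_conjTranspose,
    show u * A * u.conjTranspose * (u * A * u.conjTranspose).conjTranspose =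
      u * A * (u.conjTranspose * u) * A.conjTranspose * u.conjTranspose by
        simp only [Matrix.conjTranspose_mul, Matrix.conjTranspose_conjTranspose, mul_assoc],
    huu, mul_one, Matrix.trace_mul_comm, ← mul_assoc, ← mul_assoc, huu, one_mul]

theorem exists_eq_unitary_conj_diagonal {A : Matrix ι ι 𝕜} (hA : A.IsHermitian) :
    ∃ u ∈ Matrix.unitaryGroup ι 𝕜, ∃ α : ι → ℝ,
      A = u * Matrix.diagonal (fun i => (α i : 𝕜)) * u.conjTranspose ∧
      A.trace = ∑ i, (α i : 𝕜) ∧ frobSq A = ∑ i, α i ^ 2 := by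
  have hspec : A = (hA.eigenvectorUnitary : Matrix ι ι 𝕜) *
      Matrix.diagonal (fun i => (hA.eigenvalues i : 𝕜)) *
      (hA.eigenvectorUnitary : Matrix ι ι 𝕜).conjTranspose := hA.spectral_theorem
  refine ⟨_, hA.eigenvectorUnitary.2, hA.eigenvalues, hspec, hA.trace_eq_sum_eigenvalues, ?_⟩
  conv_lhs => rw [hspec]
  rw [frobSq_unitary_conj hA.eigenvectorUnitary.2, frobSq_diagonal]
  simp

end Frobenius

section TracelessHermitian

variable {ι 𝕜 : Type*} [Fintype ι] [RCLike 𝕜]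

variable (ι 𝕜) in
/-- The real vector space of traceless Hermitian matrices: `i` times the Lie algebra of `SU(n)` for
`𝕜 = ℂ`, the traceless symmetric matrices for `𝕜 = ℝ`. In both cases the adjoint action of the
group on it is irreducible. -/
def tracelessHermitian : Submodule ℝ (Matrix ι ι 𝕜) where
  carrier := {A | A.IsHermitian ∧ A.trace = 0}
  zero_mem' := ⟨Matrix.isHermitian_zero, Matrix.trace_zero _ _⟩
  add_mem' := fun hA hB => ⟨hA.1.add hB.1, by rw [Matrix.trace_add, hA.2, hB.2, add_zero]⟩
  smul_mem' := fun r A hA => ⟨by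
    rw [Matrix.IsHermitian, Matrix.conjTranspose_smul, hA.1.eq, star_trivial], by
    rw [Matrix.trace_smul, hA.2, smul_zero]⟩

theorem lie_mem_tracelessHermitian {A h : Matrix ι ι 𝕜} (hA : A.IsHermitian)
    (hh : h.conjTranspose = -h) : h * A - A * h ∈ tracelessHermitian ι 𝕜 := by
  refine ⟨?_, by rw [Matrix.trace_sub, Matrix.trace_mul_comm, sub_self]⟩
  rw [Matrix.IsHermitian, Matrix.conjTranspose_sub, Matrix.conjTranspose_mul,
    Matrix.conjTranspose_mul, hA.eq, hh, mul_neg, neg_mul, neg_sub_neg]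

theorem unitary_conj_mem_tracelessHermitian [DecidableEq ι] {u A : Matrix ι ι 𝕜}
    (hu : u ∈ Matrix.unitaryGroup ι 𝕜) (hA : A ∈ tracelessHermitian ι 𝕜) :
    u * A * u.conjTranspose ∈ tracelessHermitian ι 𝕜 := by
  refine ⟨Matrix.isHermitian_mul_mul_conjTranspose u hA.1, ?_⟩
  rw [Matrix.trace_mul_comm, ← mul_assoc, ← Matrix.star_eq_conjTranspose,
    Matrix.mem_unitaryGroup_iff'.1 hu, one_mul, hA.2]

variable (ι 𝕜) in
theorem finrank_tracelessHermitian_le :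
    Module.finrank ℝ (tracelessHermitian ι 𝕜) ≤ 2 * Fintype.card ι ^ 2 :=
  calc Module.finrank ℝ (tracelessHermitian ι 𝕜) ≤ Module.finrank ℝ (Matrix ι ι 𝕜) :=
        Submodule.finrank_le _
    _ = Fintype.card ι ^ 2 * Module.finrank ℝ 𝕜 := by
        rw [Module.finrank_matrix, sq]
    _ ≤ Fintype.card ι ^ 2 * 2 := by gcongr; exact RCLike.finrank_le_two 𝕜
    _ = 2 * Fintype.card ι ^ 2 := mul_comm _ _

variable (ι 𝕜) in
/-- The inner product `Re Tr (A B)` on the traceless Hermitian matrices. -/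
@[reducible]
noncomputable def tracelessHermitianCore :
    InnerProductSpace.Core ℝ (tracelessHermitian ι 𝕜) where
  inner A B := RCLike.re ((A : Matrix ι ι 𝕜) * B).trace
  conj_inner_symm A B := by simp [Matrix.trace_mul_comm (B : Matrix ι ι 𝕜)]
  re_inner_nonneg A := by
    simpa [frobSq_eq_re_trace_mul_self A.2.1] using frobSq_nonneg (A : Matrix ι ι 𝕜)
  add_left A B D := by simp [add_mul]
  smul_left A B r := by simp [RCLike.smul_re]
  definite A hA := Subtype.ext <| eq_zero_of_frobSq_eq_zero <| by
    rw [frobSq_eq_re_trace_mul_self A.2.1]; exact hA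

variable (ι 𝕜) in
theorem exists_orthonormalBasis_tracelessHermitian :
    ∃ b : Fin (Module.finrank ℝ (tracelessHermitian ι 𝕜)) → Matrix ι ι 𝕜,
      (∀ i, b i ∈ tracelessHermitian ι 𝕜 ∧ frobSq (b i) = 1) ∧
      ∀ A ∈ tracelessHermitian ι 𝕜, A = ∑ i, RCLike.re (A * b i).trace • b i := by
  let := (tracelessHermitianCore ι 𝕜).toNormedAddCommGroup
  let : InnerProductSpace ℝ (tracelessHermitian ι 𝕜) :=
    InnerProductSpace.ofCore (tracelessHermitianCore ι 𝕜).toCore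
  have hinner : ∀ A B : tracelessHermitian ι 𝕜,
      inner ℝ A B = RCLike.re ((A : Matrix ι ι 𝕜) * B).trace := fun _ _ => rfl
  let b := stdOrthonormalBasis ℝ (tracelessHermitian ι 𝕜)
  refine ⟨fun i => b i, fun i => ⟨(b i).2, ?_⟩, fun A hA => ?_⟩
  · rw [frobSq_eq_re_trace_mul_self (b i).2.1, ← hinner, real_inner_self_eq_norm_sq,
      b.norm_eq_one, one_pow]
  · have hexp := congrArg (Subtype.val) (b.sum_repr' ⟨A, hA⟩)
    simpa [hinner, Matrix.trace_mul_comm A] using hexp.symm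

theorem frobSq_eq_sum_sq_re_trace_mul {κ : Type*} [Fintype κ] {b : κ → Matrix ι ι 𝕜}
    {A : Matrix ι ι 𝕜} (hA : A.IsHermitian) (hb : A = ∑ i, RCLike.re (A * b i).trace • b i) :
    frobSq A = ∑ i, RCLike.re (A * b i).trace ^ 2 := by
  rw [frobSq_eq_re_trace_mul_self hA]
  refine (congrArg (fun X => RCLike.re (A * X).trace) hb).trans ?_
  simp only [Matrix.mul_sum, Matrix.mul_smul, Matrix.trace_sum, Matrix.trace_smul, map_sum,
    RCLike.smul_re, sq]

theorem exists_mem_tracelessHermitian_repr (L : Matrix ι ι 𝕜 →ₗ[ℝ] ℝ) :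
    ∃ B ∈ tracelessHermitian ι 𝕜, ∀ A ∈ tracelessHermitian ι 𝕜,
      L A = RCLike.re (A * B).trace := by
  obtain ⟨b, hb, hexp⟩ := exists_orthonormalBasis_tracelessHermitian ι 𝕜
  refine ⟨∑ i, L (b i) • b i, Submodule.sum_smul_mem _ _ fun i _ => (hb i).1, fun A hA => ?_⟩
  conv_lhs => rw [hexp A hA]
  simp [Matrix.mul_sum, Matrix.trace_sum, RCLike.smul_re, mul_comm]

end TracelessHermitian

section SymUnit

variable {ι 𝕜 : Type*} [DecidableEq ι] [RCLike 𝕜]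

variable (𝕜) in
/-- The symmetric matrix units `E_jk + E_kj`. They make sense over both `ℝ` and `ℂ` and their
pairings with a Hermitian matrix are twice the real parts of its entries. -/
def symUnit (j k : ι) : Matrix ι ι 𝕜 :=
  Matrix.single j k 1 + Matrix.single k j 1

theorem isHermitian_symUnit (j k : ι) : (symUnit 𝕜 j k).IsHermitian := by
  rw [Matrix.IsHermitian, symUnit, Matrix.conjTranspose_add, Matrix.conjTranspose_single,
    Matrix.conjTranspose_single, star_one, add_comm]

variable [Fintype ι]

theorem trace_mul_symUnit (A : Matrix ι ι 𝕜) (j k : ι) :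
    (A * symUnit 𝕜 j k).trace = A k j + A j k := by
  rw [symUnit, mul_add, Matrix.trace_add, Matrix.trace_mul_single, Matrix.trace_mul_single]
  simp

theorem re_two_mul (z : 𝕜) : RCLike.re (2 * z) = 2 * RCLike.re z := by
  rw [two_mul, map_add, two_mul]

theorem sum_sq_re_trace_mul_symUnit_le {A : Matrix ι ι 𝕜} (hA : A.IsHermitian) :
    ∑ j, ∑ k, RCLike.re (A * symUnit 𝕜 j k).trace ^ 2 ≤ 4 * frobSq A := by
  simp only [frobSq, Finset.mul_sum]
  refine Finset.sum_le_sum fun j _ => Finset.sum_le_sum fun k _ => ?_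
  have hre : RCLike.re (A * symUnit 𝕜 j k).trace = 2 * RCLike.re (A j k) := by
    rw [trace_mul_symUnit, ← hA.apply k j, map_add, RCLike.star_def, RCLike.conj_re, two_mul]
  calc RCLike.re (A * symUnit 𝕜 j k).trace ^ 2 = 4 * |RCLike.re (A j k)| ^ 2 := by
        rw [hre, sq_abs]; ring
    _ ≤ 4 * ‖A j k‖ ^ 2 := by gcongr; exact RCLike.abs_re_le_norm _

theorem sum_symUnit_mul_mul_symUnit (X : Matrix ι ι 𝕜) :
    ∑ j, ∑ k, symUnit 𝕜 j k * X * symUnit 𝕜 j k =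
      (2 : 𝕜) • X.transpose + (2 * X.trace) • (1 : Matrix ι ι 𝕜) := by
  have hT : X.transpose = ∑ j, ∑ k, Matrix.single j k (X k j) :=
    Matrix.matrix_eq_sum_single _
  have hT' : X.transpose = ∑ j, ∑ k, Matrix.single k j (X j k) := hT.trans Finset.sum_comm
  have hD : ∑ j, ∑ k, Matrix.single j j (X k k) = X.trace • (1 : Matrix ι ι 𝕜) := by
    have hrow : ∀ j : ι, ∑ k, Matrix.single j j (X k k) = X.trace • Matrix.single j j 1 :=
      fun j => by
        rw [Matrix.smul_single, smul_eq_mul, mul_one]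
        exact (map_sum (Matrix.singleLinearMap 𝕜 j j) _ _).symm
    simp only [hrow, ← Finset.smul_sum, ← Matrix.diagonal_one, Matrix.sum_single_eq_diagonal]
  have hD' : ∑ j, ∑ k, Matrix.single k k (X j j) = X.trace • (1 : Matrix ι ι 𝕜) :=
    Finset.sum_comm.trans hD
  simp only [symUnit, add_mul, mul_add, Matrix.single_mul_mul_single, one_mul, mul_one,
    Finset.sum_add_distrib, hD, hD', ← hT, ← hT', mul_smul, two_smul]
  abel

theorem frobSq_lie {S h : Matrix ι ι 𝕜} (hS : S.IsHermitian)
    (hh : h.conjTranspose = -h) :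
    frobSq (h * S - S * h) =
      2 * RCLike.re (S * h * S * h).trace - 2 * RCLike.re (S * 1 * S * (h * h)).trace := by
  have e₁ : (h * S * (h * S)).trace = (S * h * S * h).trace := by
    rw [← mul_assoc, Matrix.trace_mul_comm]; simp only [mul_assoc]
  have e₂ : (h * S * (S * h)).trace = (S * 1 * S * (h * h)).trace := by
    rw [mul_assoc, Matrix.trace_mul_comm]; simp only [mul_assoc, mul_one]
  have e₃ : (S * h * (h * S)).trace = (S * 1 * S * (h * h)).trace := by
    rw [← mul_assoc, Matrix.trace_mul_comm]; simp only [mul_assoc, mul_one]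
  rw [frobSq_eq_re_trace_mul_self (lie_mem_tracelessHermitian hS hh).1, sub_mul, mul_sub, mul_sub,
    Matrix.trace_sub, Matrix.trace_sub, Matrix.trace_sub, e₁, e₂, e₃, ← mul_assoc (S * h)]
  simp only [map_sub]
  ring

theorem sum_frobSq_lie_symUnit {h : Matrix ι ι 𝕜} (hh : h.conjTranspose = -h)
    (ht : h.trace = 0) :
    ∑ j, ∑ k, frobSq (h * symUnit 𝕜 j k - symUnit 𝕜 j k * h) =
      4 * (Fintype.card ι + 1) * frobSq h + 4 * RCLike.re (h.transpose * h).trace := by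
  have hsum : ∀ X Y : Matrix ι ι 𝕜,
      ∑ j, ∑ k, RCLike.re (symUnit 𝕜 j k * X * symUnit 𝕜 j k * Y).trace =
        2 * RCLike.re (X.transpose * Y).trace + 2 * RCLike.re (X.trace * Y.trace) := fun X Y => by
    have htr := congrArg (fun Z => RCLike.re (Z * Y).trace) (sum_symUnit_mul_mul_symUnit X)
    simpa [Finset.sum_mul, Matrix.trace_sum, add_mul, mul_assoc, re_two_mul] using htr
  have hsq : RCLike.re (h * h).trace = -frobSq h := by
    rw [frobSq_eq_re_trace_mul_conjTranspose, hh, mul_neg, Matrix.trace_neg, map_neg, neg_neg]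
  simp only [frobSq_lie (isHermitian_symUnit _ _) hh, Finset.sum_sub_distrib, ← Finset.mul_sum,
    hsum, ht, hsq, Matrix.transpose_one, one_mul, Matrix.trace_one, mul_zero,
    map_zero]
  rw [← RCLike.ofReal_natCast, RCLike.re_ofReal_mul, hsq]
  ring

theorem four_mul_frobSq_le_sum_frobSq_lie_symUnit {h : Matrix ι ι 𝕜}
    (hh : h.conjTranspose = -h) (ht : h.trace = 0) :
    4 * Fintype.card ι * frobSq h ≤ ∑ j, ∑ k, frobSq (h * symUnit 𝕜 j k - symUnit 𝕜 j k * h) := by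
  have hcs := sq_re_trace_mul_le h.transpose h
  rw [frobSq_transpose, ← sq] at hcs
  rw [sum_frobSq_lie_symUnit hh ht]
  linarith [neg_le_of_abs_le (abs_le_of_sq_le_sq hcs (frobSq_nonneg h))]

end SymUnit

section Isotropy

variable {n : ℕ} {𝕜 : Type*} [RCLike 𝕜]

/-- The matrix coefficient `g ↦ Re Tr (g A g† B)` of the adjoint representation. -/
noncomputable def adjointCoeff (A B g : Matrix (Fin n) (Fin n) 𝕜) : ℝ :=
  RCLike.re (g * A * g.conjTranspose * B).trace

theorem continuous_adjointCoeff {X : Type*} [TopologicalSpace X]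
    {A g : X → Matrix (Fin n) (Fin n) 𝕜} (hA : Continuous A) (hg : Continuous g)
    (B : Matrix (Fin n) (Fin n) 𝕜) : Continuous fun x => adjointCoeff (A x) B (g x) :=
  RCLike.continuous_re.comp
    (((hg.matrix_mul hA).matrix_mul hg.matrix_conjTranspose).matrix_mul
      continuous_const).matrix_trace

theorem integrable_adjointCoeff_sq (A B : Matrix (Fin n) (Fin n) 𝕜) :
    Integrable (fun g : Matrix.specialUnitaryGroup (Fin n) 𝕜 =>
      adjointCoeff A B (g : Matrix _ _ 𝕜) ^ 2) (haarProb _) :=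
  integrable_haarProb_of_continuous
    ((continuous_adjointCoeff continuous_const continuous_subtype_val B).pow 2)

theorem adjointCoeff_diagonal (α β : Fin n → ℝ) (g : Matrix (Fin n) (Fin n) 𝕜) :
    adjointCoeff (Matrix.diagonal fun i => (α i : 𝕜)) (Matrix.diagonal fun i => (β i : 𝕜)) g =
      ∑ i, ∑ j, β i * α j * entrySq g i j := by
  simp only [adjointCoeff, Matrix.trace, Matrix.diag, Matrix.mul_diagonal, map_sum]
  refine Finset.sum_congr rfl fun i _ => ?_
  rw [Matrix.mul_apply, Finset.sum_mul, map_sum]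
  refine Finset.sum_congr rfl fun j _ => ?_
  have hreal : g i j * (α j : 𝕜) * (starRingEnd 𝕜) (g i j) * (β i : 𝕜) =
      ((β i * α j * entrySq g i j : ℝ) : 𝕜) := by
    rw [mul_right_comm (g i j), RCLike.mul_conj, entrySq]
    push_cast
    ring
  rw [Matrix.mul_diagonal, Matrix.conjTranspose_apply, RCLike.star_def, hreal, RCLike.ofReal_re]

theorem adjointCoeff_unitary_conj (A B u v g : Matrix (Fin n) (Fin n) 𝕜) :
    adjointCoeff (u * A * u.conjTranspose) (v * B * v.conjTranspose) g =
      adjointCoeff A B (v.conjTranspose * g * u) := by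
  rw [adjointCoeff, adjointCoeff, ← mul_assoc, Matrix.trace_mul_comm]
  simp only [Matrix.conjTranspose_mul, Matrix.conjTranspose_conjTranspose, mul_assoc]

theorem integral_comp_adjointCoeff_unitary_conj_diagonal [NeZero n] (F : ℝ → ℝ) (α β : Fin n → ℝ)
    {u v : Matrix (Fin n) (Fin n) 𝕜} (hu : u ∈ Matrix.unitaryGroup (Fin n) 𝕜)
    (hv : v ∈ Matrix.unitaryGroup (Fin n) 𝕜) :
    ∫ g : Matrix.specialUnitaryGroup (Fin n) 𝕜,
      F (adjointCoeff (u * Matrix.diagonal (fun i => (α i : 𝕜)) * u.conjTranspose)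
        (v * Matrix.diagonal (fun i => (β i : 𝕜)) * v.conjTranspose) (g : Matrix _ _ 𝕜))
        ∂haarProb _ =
      ∫ g : Matrix.specialUnitaryGroup (Fin n) 𝕜,
        F (∑ i, ∑ j, β i * α j * entrySq (g : Matrix _ _ 𝕜) i j) ∂haarProb _ := by
  simp only [adjointCoeff_unitary_conj, adjointCoeff_diagonal]
  exact integral_entrySq_mul_mul (Unitary.star_mem hv) hu
    fun p => F (∑ i, ∑ j, β i * α j * p i j)

theorem sum_eq_zero_of_trace_eq_zero {A : Matrix (Fin n) (Fin n) 𝕜} (hA : A.trace = 0)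
    {α : Fin n → ℝ} (hα : A.trace = ∑ i, (α i : 𝕜)) : ∑ i, α i = 0 := by
  rw [hA] at hα
  exact_mod_cast hα.symm

theorem integral_adjointCoeff [NeZero n] {A B : Matrix (Fin n) (Fin n) 𝕜}
    (hA : A ∈ tracelessHermitian (Fin n) 𝕜) (hB : B.IsHermitian) :
    ∫ g : Matrix.specialUnitaryGroup (Fin n) 𝕜, adjointCoeff A B (g : Matrix _ _ 𝕜) ∂haarProb _ =
      0 := by
  obtain ⟨u, hu, α, hAu, hα, -⟩ := exists_eq_unitary_conj_diagonal hA.1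
  obtain ⟨v, hv, β, hBv, -, -⟩ := exists_eq_unitary_conj_diagonal hB
  rw [hAu, hBv]
  exact (integral_comp_adjointCoeff_unitary_conj_diagonal id α β hu hv).trans
    (integral_bilinear_entrySq β (sum_eq_zero_of_trace_eq_zero hA.2 hα))

theorem exists_integral_adjointCoeff_sq (n : ℕ) [Nontrivial (Fin n)] (𝕜 : Type*) [RCLike 𝕜] :
    ∃ e : ℝ, ∀ A ∈ tracelessHermitian (Fin n) 𝕜, ∀ B ∈ tracelessHermitian (Fin n) 𝕜,
      ∫ g : Matrix.specialUnitaryGroup (Fin n) 𝕜, adjointCoeff A B (g : Matrix _ _ 𝕜) ^ 2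
        ∂haarProb _ = e * frobSq A * frobSq B := by
  have : NeZero n := ⟨(Fin.pos_iff_nonempty.2 inferInstance).ne'⟩
  obtain ⟨e, he⟩ := exists_integral_bilinear_entrySq_sq n 𝕜
  refine ⟨e, fun A hA B hB => ?_⟩
  obtain ⟨u, hu, α, hAu, hα, hα₂⟩ := exists_eq_unitary_conj_diagonal hA.1
  obtain ⟨v, hv, β, hBv, hβ, hβ₂⟩ := exists_eq_unitary_conj_diagonal hB.1
  rw [hα₂, hβ₂, ← he α β (sum_eq_zero_of_trace_eq_zero hA.2 hα)
    (sum_eq_zero_of_trace_eq_zero hB.2 hβ), hAu, hBv]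
  exact integral_comp_adjointCoeff_unitary_conj_diagonal (· ^ 2) α β hu hv

-- Summing `B` over an orthonormal basis determines the constant: by Parseval, the squared
-- coefficients add up to `frobSq (g A g†) = frobSq A` for every `g`.
theorem finrank_mul_integral_adjointCoeff_sq [Nontrivial (Fin n)]
    {A B : Matrix (Fin n) (Fin n) 𝕜} (hA : A ∈ tracelessHermitian (Fin n) 𝕜)
    (hB : B ∈ tracelessHermitian (Fin n) 𝕜) :
    Module.finrank ℝ (tracelessHermitian (Fin n) 𝕜) *
      ∫ g : Matrix.specialUnitaryGroup (Fin n) 𝕜, adjointCoeff A B (g : Matrix _ _ 𝕜) ^ 2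
        ∂haarProb _ = frobSq A * frobSq B := by
  obtain ⟨e, he⟩ := exists_integral_adjointCoeff_sq n 𝕜
  obtain ⟨b, hb, hexp⟩ := exists_orthonormalBasis_tracelessHermitian (Fin n) 𝕜
  have hparseval : ∀ g : Matrix.specialUnitaryGroup (Fin n) 𝕜,
      ∑ i, adjointCoeff A (b i) (g : Matrix _ _ 𝕜) ^ 2 = frobSq A := fun g => by
    have hg := (Matrix.mem_specialUnitaryGroup_iff.1 g.2).1
    have hgA := unitary_conj_mem_tracelessHermitian hg hA
    rw [← frobSq_unitary_conj hg A, frobSq_eq_sum_sq_re_trace_mul hgA.1 (hexp _ hgA)]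
    rfl
  have htotal : frobSq A =
      Module.finrank ℝ (tracelessHermitian (Fin n) 𝕜) * (e * frobSq A) := by
    calc frobSq A = ∫ g : Matrix.specialUnitaryGroup (Fin n) 𝕜,
          ∑ i, adjointCoeff A (b i) (g : Matrix _ _ 𝕜) ^ 2 ∂haarProb _ := by simp [hparseval]
      _ = ∑ i, e * frobSq A * frobSq (b i) := by
        rw [integral_finsetSum _ fun i _ => integrable_adjointCoeff_sq _ _]
        exact Finset.sum_congr rfl fun i _ => he A hA (b i) (hb i).1
      _ = Module.finrank ℝ (tracelessHermitian (Fin n) 𝕜) * (e * frobSq A) := by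
        simp [(hb _).2]
  rw [he A hA B hB, ← mul_assoc, ← htotal]

end Isotropy

section Variance

variable {n : ℕ} {𝕜 : Type*} [RCLike 𝕜]

instance secondCountableTopology_specialUnitaryGroup :
    SecondCountableTopology (Matrix.specialUnitaryGroup (Fin n) 𝕜) :=
  have : SecondCountableTopology (Matrix (Fin n) (Fin n) 𝕜) :=
    inferInstanceAs (SecondCountableTopology (Fin n → Fin n → 𝕜))
  TopologicalSpace.Subtype.secondCountableTopology _

/-- The commutator `[h, g D g†]`. -/
def lieConj (h D g : Matrix (Fin n) (Fin n) 𝕜) : Matrix (Fin n) (Fin n) 𝕜 :=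
  h * (g * D * g.conjTranspose) - g * D * g.conjTranspose * h

theorem lieConj_mem_tracelessHermitian {h D : Matrix (Fin n) (Fin n) 𝕜}
    (hh : h.conjTranspose = -h) (hD : D.IsHermitian) (g : Matrix (Fin n) (Fin n) 𝕜) :
    lieConj h D g ∈ tracelessHermitian (Fin n) 𝕜 :=
  lie_mem_tracelessHermitian (Matrix.isHermitian_mul_mul_conjTranspose g hD) hh

theorem continuous_lieConj (h D : Matrix (Fin n) (Fin n) 𝕜) :
    Continuous fun g : Matrix.specialUnitaryGroup (Fin n) 𝕜 => lieConj h D (g : Matrix _ _ 𝕜) := by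
  have hconj : Continuous fun g : Matrix.specialUnitaryGroup (Fin n) 𝕜 =>
      (g : Matrix _ _ 𝕜) * D * (g : Matrix _ _ 𝕜).conjTranspose :=
    (continuous_subtype_val.matrix_mul continuous_const).matrix_mul
      continuous_subtype_val.matrix_conjTranspose
  exact (continuous_const.matrix_mul hconj).sub (hconj.matrix_mul continuous_const)

theorem adjointCoeff_lie (h D S g : Matrix (Fin n) (Fin n) 𝕜) :
    adjointCoeff D (h * S - S * h) g = -RCLike.re (lieConj h D g * S).trace := by
  rw [adjointCoeff, lieConj, mul_sub, sub_mul, Matrix.trace_sub, Matrix.trace_sub, ← mul_assoc,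
    ← mul_assoc, Matrix.trace_mul_comm (_ * S) h, ← mul_assoc, map_sub, map_sub, neg_sub]

theorem sum_adjointCoeff_lie_symUnit_sq_le {h D : Matrix (Fin n) (Fin n) 𝕜}
    (hh : h.conjTranspose = -h) (hD : D.IsHermitian) (g : Matrix (Fin n) (Fin n) 𝕜) :
    ∑ j, ∑ k, adjointCoeff D (h * symUnit 𝕜 j k - symUnit 𝕜 j k * h) g ^ 2 ≤
      4 * frobSq (lieConj h D g) := by
  simp only [adjointCoeff_lie, neg_sq]
  exact sum_sq_re_trace_mul_symUnit_le (lieConj_mem_tracelessHermitian hh hD g).1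

theorem mul_frobSq_mul_frobSq_le_integral_frobSq_lieConj [Nontrivial (Fin n)]
    {h D : Matrix (Fin n) (Fin n) 𝕜} (hh : h.conjTranspose = -h) (ht : h.trace = 0)
    (hD : D ∈ tracelessHermitian (Fin n) 𝕜) :
    n * frobSq D * frobSq h ≤ Module.finrank ℝ (tracelessHermitian (Fin n) 𝕜) *
      ∫ g : Matrix.specialUnitaryGroup (Fin n) 𝕜, frobSq (lieConj h D (g : Matrix _ _ 𝕜))
        ∂haarProb _ := by
  set N : ℝ := (Module.finrank ℝ (tracelessHermitian (Fin n) 𝕜) : ℝ)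
  let L : Fin n → Fin n → Matrix (Fin n) (Fin n) 𝕜 :=
    fun j k => h * symUnit 𝕜 j k - symUnit 𝕜 j k * h
  have hsum : ∫ g : Matrix.specialUnitaryGroup (Fin n) 𝕜,
      ∑ j, ∑ k, adjointCoeff D (L j k) (g : Matrix _ _ 𝕜) ^ 2 ∂haarProb _ ≤
      ∫ g : Matrix.specialUnitaryGroup (Fin n) 𝕜, 4 * frobSq (lieConj h D (g : Matrix _ _ 𝕜))
        ∂haarProb _ :=
    integral_mono
      (integrable_finsetSum _ fun j _ => integrable_finsetSum _ fun k _ =>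
        integrable_adjointCoeff_sq _ _)
      ((integrable_haarProb_of_continuous
        (continuous_frobSq.comp (continuous_lieConj h D))).const_mul 4)
      fun g => sum_adjointCoeff_lie_symUnit_sq_le hh hD.1 _
  rw [integral_finsetSum _ fun j _ => integrable_finsetSum _ fun k _ =>
    integrable_adjointCoeff_sq _ _, integral_const_mul] at hsum
  simp only [integral_finsetSum _ fun k _ => integrable_adjointCoeff_sq D (L _ k)] at hsum
  refine le_of_mul_le_mul_left ?_ (four_pos (α := ℝ))
  calc 4 * (n * frobSq D * frobSq h) = frobSq D * (4 * n * frobSq h) := by ring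
    _ ≤ frobSq D * ∑ j, ∑ k, frobSq (L j k) :=
        mul_le_mul_of_nonneg_left (by simpa using four_mul_frobSq_le_sum_frobSq_lie_symUnit hh ht)
          (frobSq_nonneg D)
    _ = N * ∑ j, ∑ k, ∫ g : Matrix.specialUnitaryGroup (Fin n) 𝕜,
          adjointCoeff D (L j k) (g : Matrix _ _ 𝕜) ^ 2 ∂haarProb _ := by
        simp only [Finset.mul_sum]
        refine Finset.sum_congr rfl fun j _ => Finset.sum_congr rfl fun k _ => ?_
        exact (finrank_mul_integral_adjointCoeff_sq hD
          (lie_mem_tracelessHermitian (isHermitian_symUnit j k) hh)).symm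
    _ ≤ N * (4 * ∫ g : Matrix.specialUnitaryGroup (Fin n) 𝕜,
          frobSq (lieConj h D (g : Matrix _ _ 𝕜)) ∂haarProb _) :=
        mul_le_mul_of_nonneg_left hsum (Nat.cast_nonneg _)
    _ = _ := by ring

variable (h D B : Matrix (Fin n) (Fin n) 𝕜)

/-- The real part of the abstracted gradient on the level of `n × n` matrices, up to a constant
factor: `(g₊, g₋) ↦ Re Tr (g₋ [h, g₊ D g₊†] g₋† B)`. -/
noncomputable def oneBodyGradient (g : Matrix.specialUnitaryGroup (Fin n) 𝕜 ×
    Matrix.specialUnitaryGroup (Fin n) 𝕜) : ℝ :=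
  adjointCoeff (lieConj h D (g.1 : Matrix _ _ 𝕜)) B (g.2 : Matrix _ _ 𝕜)

theorem continuous_oneBodyGradient : Continuous (oneBodyGradient h D B) :=
  continuous_adjointCoeff ((continuous_lieConj h D).comp continuous_fst)
    (continuous_subtype_val.comp continuous_snd) B

theorem integrable_oneBodyGradient_pow (m : ℕ) :
    Integrable (fun g => oneBodyGradient h D B g ^ m) ((haarProb _).prod (haarProb _)) :=
  ((continuous_oneBodyGradient h D B).pow m).integrable_of_hasCompactSupport
    (HasCompactSupport.of_compactSpace _)

variable {h D B}

theorem integral_oneBodyGradient [NeZero n] (hh : h.conjTranspose = -h) (hD : D.IsHermitian)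
    (hB : B.IsHermitian) :
    ∫ g, oneBodyGradient h D B g ∂(haarProb _).prod (haarProb _) = 0 := by
  rw [integral_prod _ (by simpa using integrable_oneBodyGradient_pow h D B 1)]
  simp only [oneBodyGradient,
    integral_adjointCoeff (lieConj_mem_tracelessHermitian hh hD _) hB, integral_zero]

theorem finrank_mul_integral_oneBodyGradient_sq [Nontrivial (Fin n)] (hh : h.conjTranspose = -h)
    (hD : D.IsHermitian) (hB : B ∈ tracelessHermitian (Fin n) 𝕜) :
    Module.finrank ℝ (tracelessHermitian (Fin n) 𝕜) *
      ∫ g, oneBodyGradient h D B g ^ 2 ∂(haarProb _).prod (haarProb _) =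
      (∫ g : Matrix.specialUnitaryGroup (Fin n) 𝕜, frobSq (lieConj h D (g : Matrix _ _ 𝕜))
        ∂haarProb _) * frobSq B := by
  rw [integral_prod _ (integrable_oneBodyGradient_pow h D B 2), ← integral_const_mul,
    ← integral_mul_const]
  simp only [oneBodyGradient, finrank_mul_integral_adjointCoeff_sq
    (lieConj_mem_tracelessHermitian hh hD _) hB]

theorem frobSq_mul_frobSq_mul_frobSq_le_variance_oneBodyGradient [Nontrivial (Fin n)]
    (hh : h.conjTranspose = -h) (ht : h.trace = 0) (hD : D ∈ tracelessHermitian (Fin n) 𝕜)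
    (hB : B ∈ tracelessHermitian (Fin n) 𝕜) :
    frobSq D * frobSq h * frobSq B ≤ 4 * n ^ 3 *
      ProbabilityTheory.variance (oneBodyGradient h D B) ((haarProb _).prod (haarProb _)) := by
  have hn : 0 < n := Fin.pos_iff_nonempty.2 inferInstance
  have : NeZero n := ⟨hn.ne'⟩
  rw [ProbabilityTheory.variance_of_integral_eq_zero
    (continuous_oneBodyGradient h D B).measurable.aemeasurable
    (integral_oneBodyGradient hh hD.1 hB.1)]
  set V : ℝ := ∫ g, oneBodyGradient h D B g ^ 2 ∂(haarProb _).prod (haarProb _)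
  have : 0 ≤ V := integral_nonneg fun _ => sq_nonneg _
  have hN : (Module.finrank ℝ (tracelessHermitian (Fin n) 𝕜) : ℝ) ≤ 2 * n ^ 2 := by
    exact_mod_cast Fintype.card_fin n ▸ finrank_tracelessHermitian_le (Fin n) 𝕜
  refine le_of_mul_le_mul_left ?_ (Nat.cast_pos (α := ℝ).2 hn)
  calc (n : ℝ) * (frobSq D * frobSq h * frobSq B) = n * frobSq D * frobSq h * frobSq B := by ring
    _ ≤ _ * _ * frobSq B := mul_le_mul_of_nonneg_right
        (mul_frobSq_mul_frobSq_le_integral_frobSq_lieConj hh ht hD) (frobSq_nonneg B)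
    _ = (Module.finrank ℝ (tracelessHermitian (Fin n) 𝕜) : ℝ) ^ 2 * V := by
        rw [mul_assoc, ← finrank_mul_integral_oneBodyGradient_sq hh hD.1 hB, ← mul_assoc, sq]
    _ ≤ (2 * n ^ 2) ^ 2 * V := by gcongr
    _ = n * (4 * n ^ 3 * V) := by ring

end Variance

section Transfer

variable {n : ℕ}

theorem compoundMatrix_conj_compoundDifferential {g : Matrix (Fin n) (Fin n) ℂ}
    (hg : g * g.conjTranspose = 1) (A : Matrix (Fin n) (Fin n) ℂ) :
    compoundMatrix g * compoundDifferential A * (compoundMatrix g).conjTranspose =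
      compoundDifferential (g * A * g.conjTranspose) := by
  rw [← compoundMatrix_conjTranspose, compoundMatrix_mul_compoundDifferential_mul hg]

theorem compoundMatrix_conj_sum_smul_sigmaZ {g : Matrix (Fin n) (Fin n) ℂ}
    (hg : g * g.conjTranspose = 1) (c : Fin n → ℝ) :
    compoundMatrix g * (∑ i, (c i : ℂ) • sigmaZ i) * (compoundMatrix g).conjTranspose =
      ((∑ i, c i : ℝ) : ℂ) • (1 : Matrix (Qubits n) (Qubits n) ℂ) - (2 : ℂ) •
        compoundDifferential (g * Matrix.diagonal (fun i => (c i : ℂ)) * g.conjTranspose) := by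
  have hunitary : compoundMatrix g * (compoundMatrix g).conjTranspose = 1 := by
    rw [← compoundMatrix_conjTranspose, ← compoundMatrix_mul, hg, compoundMatrix_one]
  rw [sum_smul_sigmaZ, mul_sub, sub_mul, mul_smul_comm, smul_mul_assoc, mul_one, hunitary,
    mul_smul_comm, smul_mul_assoc, compoundMatrix_conj_compoundDifferential hg]

theorem abstractedGradient_compoundMatrix {g₁ g₂ : Matrix (Fin n) (Fin n) ℂ}
    (hg₁ : g₁ * g₁.conjTranspose = 1) (hg₂ : g₂ * g₂.conjTranspose = 1)
    (h : Matrix (Fin n) (Fin n) ℂ) (c : Fin n → ℝ) (ρ : Matrix (Qubits n) (Qubits n) ℂ) :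
    abstractedGradient (compoundDifferential h) (∑ i, (c i : ℂ) • sigmaZ i) ρ
      (compoundMatrix g₁) (compoundMatrix g₂) =
      -2 * (ρ * compoundDifferential (g₂ *
        lieConj h (Matrix.diagonal fun i => (c i : ℂ)) g₁ * g₂.conjTranspose)).trace := by
  have hlie (x : ℂ) (P Q : Matrix (Qubits n) (Qubits n) ℂ) :
      P * (x • 1 - (2 : ℂ) • Q) - (x • 1 - (2 : ℂ) • Q) * P = (-2 : ℂ) • (P * Q - Q * P) := by
    simp only [mul_sub, sub_mul, mul_smul_comm, smul_mul_assoc, mul_one, one_mul]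
    module
  rw [abstractedGradient, compoundMatrix_conj_sum_smul_sigmaZ hg₁, hlie,
    ← compoundDifferential_lie, mul_smul_comm, Matrix.trace_smul, smul_eq_mul,
    ← compoundMatrix_conj_compoundDifferential hg₂, mul_assoc, mul_assoc, Matrix.trace_mul_comm]
  simp only [mul_assoc, lieConj]

variable {𝕜 : Type*} [RCLike 𝕜]

theorem specialUnitaryGroup_mul_conjTranspose (g : Matrix.specialUnitaryGroup (Fin n) 𝕜) :
    (g : Matrix (Fin n) (Fin n) 𝕜) * (g : Matrix (Fin n) (Fin n) 𝕜).conjTranspose = 1 :=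
  Matrix.mem_unitaryGroup_iff.1 (Matrix.mem_specialUnitaryGroup_iff.1 g.2).1

variable (𝕜) in
/-- The diagonal matrix with entries `cᵢ - c̄`, the traceless part of `diagonal c`. -/
noncomputable def centredDiagonal (c : Fin n → ℝ) : Matrix (Fin n) (Fin n) 𝕜 :=
  Matrix.diagonal fun i => ((c i - (∑ j, c j) / n : ℝ) : 𝕜)

theorem centredDiagonal_mem_tracelessHermitian [NeZero n] (c : Fin n → ℝ) :
    centredDiagonal 𝕜 c ∈ tracelessHermitian (Fin n) 𝕜 := by
  have hsum : ∑ i, (c i - (∑ j, c j) / n) = 0 := by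
    simp [Finset.sum_sub_distrib, mul_div_cancel₀, NeZero.ne]
  refine ⟨?_, ?_⟩
  · exact Matrix.isHermitian_diagonal_of_self_adjoint _
      (funext fun i => RCLike.conj_ofReal _)
  · rw [centredDiagonal, Matrix.trace_diagonal, ← RCLike.ofReal_sum, hsum, RCLike.ofReal_zero]

theorem frobSq_centredDiagonal (c : Fin n → ℝ) : frobSq (centredDiagonal 𝕜 c) = spread c := by
  simp only [centredDiagonal, frobSq_diagonal, RCLike.norm_ofReal, sq_abs, spread]

theorem lieConj_centredDiagonal {g : Matrix (Fin n) (Fin n) 𝕜} (hg : g * g.conjTranspose = 1)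
    (h : Matrix (Fin n) (Fin n) 𝕜) (c : Fin n → ℝ) :
    lieConj h (centredDiagonal 𝕜 c) g = lieConj h (Matrix.diagonal fun i => (c i : 𝕜)) g := by
  have hc : centredDiagonal 𝕜 c =
      Matrix.diagonal (fun i => (c i : 𝕜)) - (((∑ j, c j) / n : ℝ) : 𝕜) • 1 := by
    rw [Matrix.smul_one_eq_diagonal, Matrix.diagonal_sub, centredDiagonal]
    simp only [RCLike.ofReal_sub]
  simp only [lieConj, hc, mul_sub, sub_mul, mul_smul_comm, smul_mul_assoc, mul_one, one_mul, hg]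
  abel

variable (ε : 𝕜 →⋆ₐ[ℝ] ℂ)

theorem starAlgHom_ofReal (r : ℝ) : ε (r : 𝕜) = r := AlgHomClass.commutes ε r

theorem lieConj_map (h D g : Matrix (Fin n) (Fin n) 𝕜) :
    (lieConj h D g).map ε = lieConj (h.map ε) (D.map ε) (g.map ε) := by
  simp only [lieConj, Matrix.map_sub ε (map_sub ε), Matrix.map_mul,
    Matrix.conjTranspose_map ε (map_star ε)]

/-- The compound ansatz for `SU(n)` or `SO(n)`, with the embedding of the field of matrix entries
into `ℂ` as parameter, so that both groups are treated at once. -/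
noncomputable def compoundRep (g : Matrix.specialUnitaryGroup (Fin n) 𝕜) :
    Matrix (Qubits n) (Qubits n) ℂ :=
  compoundMatrix ((g : Matrix (Fin n) (Fin n) 𝕜).map ε)

/-- The expectation value `Re Tr (ρ dφ(M))` of a one-body operator, as a functional of `M`. -/
noncomputable def oneBodyExpectation (ρ : Matrix (Qubits n) (Qubits n) ℂ) :
    Matrix (Fin n) (Fin n) 𝕜 →ₗ[ℝ] ℝ where
  toFun M := (ρ * compoundDifferential (M.map ε)).trace.re
  map_add' A B := by
    rw [Matrix.map_add ε (map_add ε), compoundDifferential_add, mul_add, Matrix.trace_add,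
      Complex.add_re]
  map_smul' r A := by
    have hmap : (r • A).map ε = (r : ℂ) • A.map ε := by
      ext i j
      rw [Matrix.map_apply, Matrix.smul_apply, RCLike.real_smul_eq_coe_mul, map_mul,
        starAlgHom_ofReal, Matrix.smul_apply, Matrix.map_apply, smul_eq_mul]
    rw [hmap, compoundDifferential_smul, mul_smul_comm, Matrix.trace_smul, smul_eq_mul,
      Complex.re_ofReal_mul, RingHom.id_apply, smul_eq_mul]

theorem oneBodyExpectation_apply (ρ : Matrix (Qubits n) (Qubits n) ℂ)
    (M : Matrix (Fin n) (Fin n) 𝕜) :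
    oneBodyExpectation ε ρ M = (ρ * compoundDifferential (M.map ε)).trace.re := rfl

variable (h : Matrix (Fin n) (Fin n) 𝕜) (c : Fin n → ℝ) (ρ : Matrix (Qubits n) (Qubits n) ℂ)

theorem re_abstractedGradient_compoundRep (g₁ g₂ : Matrix.specialUnitaryGroup (Fin n) 𝕜) :
    (abstractedGradient (compoundDifferential (h.map ε)) (∑ i, (c i : ℂ) • sigmaZ i) ρ
      (compoundRep ε g₁) (compoundRep ε g₂)).re =
      -2 * oneBodyExpectation ε ρ ((g₂ : Matrix _ _ 𝕜) *
        lieConj h (centredDiagonal 𝕜 c) (g₁ : Matrix _ _ 𝕜) *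
          (g₂ : Matrix _ _ 𝕜).conjTranspose) := by
  have hunitary (g : Matrix.specialUnitaryGroup (Fin n) 𝕜) :
      (g : Matrix (Fin n) (Fin n) 𝕜).map ε *
        ((g : Matrix (Fin n) (Fin n) 𝕜).map ε).conjTranspose = 1 := by
    rw [← Matrix.conjTranspose_map ε (map_star ε), ← Matrix.map_mul,
      specialUnitaryGroup_mul_conjTranspose, Matrix.map_one ε (map_zero ε) (map_one ε)]
  have hdiag : (Matrix.diagonal fun i => (c i : 𝕜)).map ε =
      Matrix.diagonal fun i => (c i : ℂ) := by
    rw [Matrix.diagonal_map (map_zero ε)]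
    simp only [starAlgHom_ofReal]
  rw [compoundRep, compoundRep, abstractedGradient_compoundMatrix (hunitary g₁) (hunitary g₂),
    lieConj_centredDiagonal (specialUnitaryGroup_mul_conjTranspose g₁), oneBodyExpectation_apply,
    Matrix.map_mul, Matrix.map_mul, lieConj_map, hdiag, Matrix.conjTranspose_map ε (map_star ε)]
  simp

variable {h ρ}

theorem gradVar_compoundRep [NeZero n] (hh : h.conjTranspose = -h) {B : Matrix (Fin n) (Fin n) 𝕜}
    (hB : ∀ A ∈ tracelessHermitian (Fin n) 𝕜,
      oneBodyExpectation ε ρ A = RCLike.re (A * B).trace) :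
    gradVar (compoundRep ε) (compoundDifferential (h.map ε)) (∑ i, (c i : ℂ) • sigmaZ i) ρ =
      4 * ProbabilityTheory.variance (oneBodyGradient h (centredDiagonal 𝕜 c) B)
        ((haarProb _).prod (haarProb _)) := by
  have hgrad (g : Matrix.specialUnitaryGroup (Fin n) 𝕜 × Matrix.specialUnitaryGroup (Fin n) 𝕜) :
      (abstractedGradient (compoundDifferential (h.map ε)) (∑ i, (c i : ℂ) • sigmaZ i) ρ
        (compoundRep ε g.1) (compoundRep ε g.2)).re =
      -2 * oneBodyGradient h (centredDiagonal 𝕜 c) B g := by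
    have hD := (centredDiagonal_mem_tracelessHermitian (𝕜 := 𝕜) c).1
    rw [re_abstractedGradient_compoundRep, hB _ (unitary_conj_mem_tracelessHermitian
      (Matrix.mem_specialUnitaryGroup_iff.1 g.2.2).1 (lieConj_mem_tracelessHermitian hh hD _))]
    rfl
  simp only [gradVar, hgrad, ProbabilityTheory.variance_const_mul]
  norm_num

theorem sq_oneBodyExpectation_mul_le_gradVar_compoundRep [Nontrivial (Fin n)]
    (hh : h.conjTranspose = -h) (ht : h.trace = 0) {S : Matrix (Fin n) (Fin n) 𝕜}
    (hS : S ∈ tracelessHermitian (Fin n) 𝕜) :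
    oneBodyExpectation ε ρ S ^ 2 * (frobSq h * spread c) ≤ frobSq S * (n ^ 3 *
      gradVar (compoundRep ε) (compoundDifferential (h.map ε)) (∑ i, (c i : ℂ) • sigmaZ i) ρ) := by
  have : NeZero n := ⟨(Fin.pos_iff_nonempty.2 inferInstance).ne'⟩
  obtain ⟨B, hB, hrepr⟩ := exists_mem_tracelessHermitian_repr (oneBodyExpectation ε ρ)
  have hvar := frobSq_mul_frobSq_mul_frobSq_le_variance_oneBodyGradient hh ht
    (centredDiagonal_mem_tracelessHermitian c) hB
  rw [frobSq_centredDiagonal] at hvar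
  calc oneBodyExpectation ε ρ S ^ 2 * (frobSq h * spread c)
      ≤ frobSq S * frobSq B * (frobSq h * spread c) := by
        rw [hrepr S hS, ← frobSq_centredDiagonal (𝕜 := 𝕜) c]
        exact mul_le_mul_of_nonneg_right (sq_re_trace_mul_le S B)
          (mul_nonneg (frobSq_nonneg _) (frobSq_nonneg _))
    _ = frobSq S * (spread c * frobSq h * frobSq B) := by ring
    _ ≤ _ := by
        rw [gradVar_compoundRep ε c hh hrepr]
        refine mul_le_mul_of_nonneg_left (hvar.trans_eq ?_) (frobSq_nonneg S)
        ring

end Transfer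

section InitialStates

variable {n : ℕ} {𝕜 : Type*} [RCLike 𝕜] (ε : 𝕜 →⋆ₐ[ℝ] ℂ)

theorem trace_pureState_mul {ι : Type*} [Fintype ι] (ψ : ι → ℂ) (A : Matrix ι ι ℂ) :
    (pureState ψ * A).trace = ∑ s, ∑ t, ψ s * star (ψ t) * A t s := by
  simp [pureState, Matrix.trace, Matrix.mul_apply, Matrix.vecMulVec_apply]

theorem oneBodyExpectation_basisKet_diagonal (s : Qubits n) (d : Fin n → ℝ) :
    oneBodyExpectation ε (pureState (basisKet s)) (Matrix.diagonal fun i => (d i : 𝕜)) =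
      ∑ i ∈ occupied s, d i := by
  rw [oneBodyExpectation_apply, Matrix.diagonal_map (map_zero ε)]
  simp only [starAlgHom_ofReal]
  rw [compoundDifferential_diagonal, trace_pureState_mul,
    Finset.sum_eq_single_of_mem s (Finset.mem_univ s) fun t _ ht => by simp [basisKet, ht],
    Finset.sum_eq_single_of_mem s (Finset.mem_univ s) fun t _ ht => by simp [basisKet, ht]]
  simp [basisKet]

theorem exists_witness_basisKet {s : Qubits n} {i j : Fin n} (hs : s i ≠ s j) :
    ∃ S ∈ tracelessHermitian (Fin n) 𝕜, frobSq S = 2 ∧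
      oneBodyExpectation ε (pureState (basisKet s)) S ^ 2 = 1 := by
  have hij : i ≠ j := fun h => hs (congrArg s h)
  have hself : IsSelfAdjoint fun k => (((Pi.single i 1 - Pi.single j 1 : Fin n → ℝ) k : ℝ) : 𝕜) :=
    funext fun _ => RCLike.conj_ofReal _
  refine ⟨_, ⟨Matrix.isHermitian_diagonal_of_self_adjoint _ hself, ?_⟩, ?_, ?_⟩
  · rw [Matrix.trace_diagonal, ← RCLike.ofReal_sum]
    simp
  · rw [frobSq_diagonal, ← Finset.sum_subset (Finset.subset_univ {i, j}) fun k _ hk => by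
      obtain ⟨hki, hkj⟩ : k ≠ i ∧ k ≠ j := by simpa using hk
      simp [hki, hkj], Finset.sum_pair hij]
    norm_num [hij, hij.symm]
  · rw [oneBodyExpectation_basisKet_diagonal]
    obtain hi | hi := Fin.exists_fin_two.1 ⟨s i, rfl⟩ <;>
      obtain hj | hj := Fin.exists_fin_two.1 ⟨s j, rfl⟩ <;>
      simp_all [mem_occupied]

theorem oneBodyExpectation_plusKet (M : Matrix (Fin n) (Fin n) 𝕜) :
    oneBodyExpectation ε (pureState (plusKet n)) M =
      (∑ s, ∑ t, compoundDifferential (M.map ε) s t).re / 2 ^ n := by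
  have hplus (s t : Qubits n) :
      plusKet n s * star (plusKet n t) = (((2 ^ n)⁻¹ : ℝ) : ℂ) := by
    rw [plusKet, plusKet, Complex.star_def, Complex.conj_ofReal, ← Complex.ofReal_mul,
      div_mul_div_comm, Real.mul_self_sqrt (by positivity), one_mul, one_div]
  rw [oneBodyExpectation_apply, trace_pureState_mul]
  simp only [hplus, ← Finset.mul_sum]
  rw [Finset.sum_comm, Complex.re_ofReal_mul, inv_mul_eq_div]

theorem oneBodyExpectation_plusKet_symUnit {a b : Fin n} (hab : a ⋖ b) :
    oneBodyExpectation ε (pureState (plusKet n)) (symUnit 𝕜 a b) = 1 / 2 := by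
  have hmap : (symUnit 𝕜 a b).map ε = Matrix.single a b 1 + Matrix.single b a 1 := by
    rw [symUnit, Matrix.map_add ε (map_add ε), Matrix.map_single, Matrix.map_single, map_one]
  have hsum := congrArg Complex.re (two_mul_sum_compoundDifferential_single_add hab)
  rw [← Complex.ofReal_ofNat, Complex.re_ofReal_mul, ← Complex.ofReal_pow, Complex.ofReal_re]
    at hsum
  rw [oneBodyExpectation_plusKet, hmap, div_eq_div_iff (by positivity) two_ne_zero, mul_comm, hsum,
    one_mul]

theorem exists_witness_plusKet [Nontrivial (Fin n)] :
    ∃ S ∈ tracelessHermitian (Fin n) 𝕜, frobSq S = 2 ∧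
      oneBodyExpectation ε (pureState (plusKet n)) S ^ 2 = 1 / 4 := by
  obtain ⟨a, b, hlt⟩ := exists_pair_lt (Fin n)
  have hcov := Order.covBy_succ_of_not_isMax hlt.not_isMax
  have hne := hcov.ne
  refine ⟨symUnit 𝕜 a (Order.succ a), ⟨isHermitian_symUnit _ _, ?_⟩, ?_, ?_⟩
  · simp [symUnit, Matrix.trace_add, Matrix.trace_single_eq_of_ne, hne, hne.symm]
  · rw [frobSq_eq_re_trace_mul_self (isHermitian_symUnit _ _), trace_mul_symUnit]
    simp [symUnit, hne, hne.symm]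
    norm_num
  · rw [oneBodyExpectation_plusKet_symUnit ε hcov]
    norm_num

theorem exists_witness_of_isInitialKet [Nontrivial (Fin n)] {ψ : Qubits n → ℂ}
    (hψ : IsInitialKet ψ) :
    ∃ S ∈ tracelessHermitian (Fin n) 𝕜, frobSq S = 2 ∧
      1 / 4 ≤ oneBodyExpectation ε (pureState ψ) S ^ 2 := by
  obtain ⟨s, ⟨i, j, hij⟩, rfl⟩ | rfl := hψ
  · obtain ⟨S, hS, hnorm, hval⟩ := exists_witness_basisKet ε hij
    exact ⟨S, hS, hnorm, by norm_num [hval]⟩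
  · obtain ⟨S, hS, hnorm, hval⟩ := exists_witness_plusKet (n := n) ε
    exact ⟨S, hS, hnorm, hval.ge⟩

theorem le_gradVar_compoundRep [Nontrivial (Fin n)] {ψ : Qubits n → ℂ} (hψ : IsInitialKet ψ)
    {h : Matrix (Fin n) (Fin n) 𝕜} (hh : h.conjTranspose = -h) (ht : h.trace = 0)
    (c : Fin n → ℝ) :
    1 / 8 / (n : ℝ) ^ 3 * frobSq h * spread c ≤
      gradVar (compoundRep ε) (compoundDifferential (h.map ε)) (∑ i, (c i : ℂ) • sigmaZ i)
        (pureState ψ) := by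
  have hn : (0 : ℝ) < n := Nat.cast_pos.2 (Fin.pos_iff_nonempty.2 inferInstance)
  obtain ⟨S, hS, hnorm, hval⟩ := exists_witness_of_isInitialKet ε hψ
  have hle := sq_oneBodyExpectation_mul_le_gradVar_compoundRep ε c (ρ := pureState ψ) hh ht hS
  have hnonneg : 0 ≤ frobSq h * spread c :=
    mul_nonneg (frobSq_nonneg h) (frobSq_centredDiagonal (𝕜 := 𝕜) c ▸ frobSq_nonneg _)
  rw [hnorm] at hle
  rw [div_mul_eq_mul_div, div_mul_eq_mul_div, div_le_iff₀ (by positivity)]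
  linarith [mul_le_mul_of_nonneg_right hval hnonneg]

end InitialStates

section Groups

variable {n : ℕ} {h : Matrix (Fin n) (Fin n) ℂ}

theorem stdNormSq_eq_frobSq (hh : h.conjTranspose = -h) : stdNormSq h = frobSq h := by
  rw [frobSq_eq_re_trace_mul_conjTranspose, hh, stdNormSq, mul_neg, Matrix.trace_neg]
  rfl

theorem le_gradVar_compoundSU [Nontrivial (Fin n)] {ψ : Qubits n → ℂ} (hψ : IsInitialKet ψ)
    (hh : h ∈ suSet n) (c : Fin n → ℝ) :
    1 / 8 / (n : ℝ) ^ 3 * stdNormSq h * spread c ≤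
      gradVar compoundSU (compoundDifferential h) (∑ i, (c i : ℂ) • sigmaZ i) (pureState ψ) := by
  have hle := le_gradVar_compoundRep (StarAlgHom.id ℝ ℂ) hψ hh.1 hh.2 c
  rw [StarAlgHom.coe_id, Matrix.map_id] at hle
  rw [stdNormSq_eq_frobSq hh.1]
  exact hle

theorem le_gradVar_compoundSO [Nontrivial (Fin n)] {ψ : Qubits n → ℂ} (hψ : IsInitialKet ψ)
    (hh : h ∈ soSet n) (c : Fin n → ℝ) :
    1 / 8 / (n : ℝ) ^ 3 * stdNormSq h * spread c ≤
      gradVar compoundSO (compoundDifferential h) (∑ i, (c i : ℂ) • sigmaZ i) (pureState ψ) := by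
  obtain ⟨r, rfl⟩ : ∃ r : Matrix (Fin n) (Fin n) ℝ, h = r.map (StarAlgHom.ofId ℝ ℂ) :=
    ⟨h.map Complex.re, by
      ext i j
      exact Complex.ext rfl (hh.2 i j)⟩
  have hskew : r.conjTranspose = -r := by
    ext i j
    simpa using congrArg Complex.re (congrFun₂ hh.1.1 i j)
  have htrace : r.trace = 0 := by
    simpa [Matrix.trace] using congrArg Complex.re hh.1.2
  have hnorm : frobSq (r.map (StarAlgHom.ofId ℝ ℂ)) = frobSq r := by simp [frobSq]
  rw [stdNormSq_eq_frobSq hh.1.1, hnorm]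
  exact le_gradVar_compoundRep (StarAlgHom.ofId ℝ ℂ) hψ hskew htrace c

theorem monotone_div_mul_stdNormSq_mul_spread (hh : h.conjTranspose = -h) (c : Fin n → ℝ) :
    Monotone fun C : ℝ => C / (n : ℝ) ^ 3 * stdNormSq h * spread c := by
  have hnorm : 0 ≤ stdNormSq h := stdNormSq_eq_frobSq hh ▸ frobSq_nonneg h
  have hspread : 0 ≤ spread c := Finset.sum_nonneg fun _ _ => sq_nonneg _
  intro C C' hC
  dsimp only
  gcongr

end Groups

section Generators

variable {n : ℕ} {h : Matrix (Fin n) (Fin n) ℂ}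

theorem half_le_spread_single [Nontrivial (Fin n)] (i : Fin n) :
    1 / 2 ≤ spread (Pi.single i (1 : ℝ)) := by
  have hn : (2 : ℝ) ≤ n := by
    exact_mod_cast Fin.nontrivial_iff_two_le.1 inferInstance
  have hsq (k : Fin n) : ((Pi.single i (1 : ℝ) : Fin n → ℝ) k - 1 / n) ^ 2 =
      (if k = i then 1 - 2 / (n : ℝ) else 0) + 1 / (n : ℝ) ^ 2 := by
    rw [Pi.single_apply]
    split_ifs <;> ring
  have hspread : spread (Pi.single i (1 : ℝ)) = 1 - 1 / n := by
    simp only [spread, Finset.sum_pi_single', Finset.mem_univ, if_true, hsq,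
      Finset.sum_add_distrib, Finset.sum_ite_eq', Finset.sum_const, Finset.card_univ,
      Fintype.card_fin, nsmul_eq_mul]
    field_simp
    ring
  have hinv : 1 / (n : ℝ) ≤ 1 / 2 := one_div_le_one_div_of_le two_pos hn
  linarith

theorem sum_single_smul_sigmaZ (i : Fin n) :
    ∑ k, ((Pi.single i (1 : ℝ) : Fin n → ℝ) k : ℂ) • sigmaZ k = sigmaZ i := by
  rw [Finset.sum_eq_single_of_mem i (Finset.mem_univ i) fun k _ hk => by simp [hk]]
  simp

theorem neg_I_div_two_smul_mem_suSet {P : Matrix (Fin n) (Fin n) ℂ} (hP : P.IsHermitian)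
    (ht : P.trace = 0) : (-(Complex.I / 2)) • P ∈ suSet n := by
  refine ⟨?_, by rw [Matrix.trace_smul, ht, smul_zero]⟩
  rw [Matrix.conjTranspose_smul, hP.eq, ← neg_smul]
  congr 1
  simp [neg_div]

theorem stdNormSq_neg_I_div_two_smul (P : Matrix (Fin n) (Fin n) ℂ) :
    stdNormSq ((-(Complex.I / 2)) • P) = (P * P).trace.re / 4 := by
  have hI : -(Complex.I / 2) * -(Complex.I / 2) = ((-(1 / 4) : ℝ) : ℂ) := by
    push_cast
    linear_combination (1 / 4) * Complex.I_mul_I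
  rw [stdNormSq, smul_mul_smul_comm, hI, Matrix.trace_smul, smul_eq_mul, Complex.neg_re,
    Complex.re_ofReal_mul]
  ring

theorem mem_suSet_and_stdNormSq_of_mem_suGenerators (hh : h ∈ suGenerators n) :
    h ∈ suSet n ∧ stdNormSq h = 1 / 2 := by
  obtain ⟨i, j, hij, rfl | rfl | rfl⟩ := hh
  · refine ⟨neg_I_div_two_smul_mem_suSet ?_ ?_, (stdNormSq_neg_I_div_two_smul _).trans ?_⟩
    · simp [Matrix.IsHermitian, pauliX, add_comm]
    · simp [pauliX, Matrix.trace_add, Matrix.trace_single_eq_of_ne, hij, hij.symm]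
    · simp [pauliX, mul_add, add_mul, hij, hij.symm, Matrix.trace_add]
      norm_num
  · refine ⟨neg_I_div_two_smul_mem_suSet ?_ ?_, (stdNormSq_neg_I_div_two_smul _).trans ?_⟩
    · simp [Matrix.IsHermitian, pauliY, add_comm]
    · simp [pauliY, Matrix.trace_add, Matrix.trace_single_eq_of_ne, hij, hij.symm]
    · simp [pauliY, mul_add, add_mul, hij, hij.symm, Matrix.trace_add]
      norm_num
  · refine ⟨neg_I_div_two_smul_mem_suSet ?_ ?_, (stdNormSq_neg_I_div_two_smul _).trans ?_⟩
    · simp [Matrix.IsHermitian, pauliZ]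
    · simp [pauliZ, Matrix.trace_sub]
    · simp [pauliZ, mul_sub, sub_mul, hij, hij.symm]
      norm_num

theorem soGenerators_subset_suGenerators : soGenerators n ⊆ suGenerators n :=
  fun _ ⟨i, j, hij, hY⟩ => ⟨i, j, hij, Or.inr (Or.inl hY)⟩

theorem soGenerators_subset_soSet : soGenerators n ⊆ soSet n := by
  intro h hh
  refine ⟨(mem_suSet_and_stdNormSq_of_mem_suGenerators
    (soGenerators_subset_suGenerators hh)).1, fun k l => ?_⟩
  obtain ⟨i, j, -, rfl⟩ := hh
  simp only [pauliY, Matrix.smul_apply, Matrix.add_apply, Matrix.single_apply]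
  split_ifs <;> simp

theorem div_le_stdNormSq_mul_spread_single [Nontrivial (Fin n)] (hh : h ∈ suGenerators n)
    (i : Fin n) :
    1 / 32 / (n : ℝ) ^ 3 ≤ 1 / 8 / (n : ℝ) ^ 3 * stdNormSq h * spread (Pi.single i (1 : ℝ)) := by
  rw [(mem_suSet_and_stdNormSq_of_mem_suGenerators hh).2]
  calc 1 / 32 / (n : ℝ) ^ 3 = 1 / 8 / (n : ℝ) ^ 3 * (1 / 2) * (1 / 2) := by ring
    _ ≤ _ := by gcongr; exact half_le_spread_single i

end Generators

theorem corollary1 :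
    (∀ (n : ℕ) (i : Fin n),
      Complex.I • sigmaZ i ∉ compoundDLA (suGenerators n) ∧
      Complex.I • sigmaZ i ∉ compoundDLA (soGenerators n)) ∧
    ∃ C : ℝ, 0 < C ∧ ∃ d : ℕ, ∀ n : ℕ, 2 ≤ n →
      ∀ ψ : Qubits n → ℂ, IsInitialKet ψ →
        -- a single `σ_z` as observable and a generator of the ansatz
        (∀ h ∈ suGenerators n, ∀ i : Fin n,
          C / (n : ℝ) ^ d ≤
            gradVar compoundSU (compoundDifferential h) (sigmaZ i) (pureState ψ)) ∧
        (∀ h ∈ soGenerators n, ∀ i : Fin n,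
          C / (n : ℝ) ^ d ≤
            gradVar compoundSO (compoundDifferential h) (sigmaZ i) (pureState ψ)) ∧
        -- a real combination of `σ_z`'s as observable and any element of the Lie algebra
        (∀ h ∈ suSet n, ∀ c : Fin n → ℝ,
          C / (n : ℝ) ^ d * stdNormSq h * spread c ≤
            gradVar compoundSU (compoundDifferential h)
              (∑ i, (c i : ℂ) • sigmaZ i) (pureState ψ)) ∧
        (∀ h ∈ soSet n, ∀ c : Fin n → ℝ,
          C / (n : ℝ) ^ d * stdNormSq h * spread c ≤
            gradVar compoundSO (compoundDifferential h)
              (∑ i, (c i : ℂ) • sigmaZ i) (pureState ψ)) := by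
  refine ⟨fun n i => ⟨I_smul_sigmaZ_notMem_compoundDLA _ i, I_smul_sigmaZ_notMem_compoundDLA _ i⟩,
    1 / 32, by norm_num, 3, fun n hn ψ hψ => ?_⟩
  have : Nontrivial (Fin n) := Fin.nontrivial_iff_two_le.2 hn
  refine ⟨fun h hh i => ?_, fun h hh i => ?_, fun h hh c => ?_, fun h hh c => ?_⟩
  · have hsu := (mem_suSet_and_stdNormSq_of_mem_suGenerators hh).1
    rw [← sum_single_smul_sigmaZ i]
    exact (div_le_stdNormSq_mul_spread_single hh i).trans (le_gradVar_compoundSU hψ hsu _)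
  · have hsu := soGenerators_subset_suGenerators hh
    rw [← sum_single_smul_sigmaZ i]
    exact (div_le_stdNormSq_mul_spread_single hsu i).trans
      (le_gradVar_compoundSO hψ (soGenerators_subset_soSet hh) _)
  · exact (monotone_div_mul_stdNormSq_mul_spread hh.1 c (by norm_num)).trans
      (le_gradVar_compoundSU hψ hh c)
  · exact (monotone_div_mul_stdNormSq_mul_spread hh.1.1 c (by norm_num)).trans
      (le_gradVar_compoundSO hψ hh c)
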